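/- Let $G$ be a compact Lie group whose Lie algebra $\mathfrak g$ is semisimple, let $\sigma$ be an automorphism of the Lie group $G$ with $\sigma^2=\mathrm{id}$, and let $H$ be the identity component of the fixed point subgroup $G^\sigma$, with Lie algebra $\mathfrak h\subset\mathfrak g$. Write $B_{\mathfrak g}$ and $B_{\mathfrak h}$ for the Killing forms of $\mathfrak g$ and of $\mathfrak h$, and let $\mathfrak p$ be the orthogonal complement of $\mathfrak h$ in $\mathfrak g$ with respect to $B_{\mathfrak g}$. Let $M=G/H$ carry its quotient smooth structure (the one for which $\pi\colon G\to G/H$ is a smooth submersion), put $o=\pi(1)$, and identify $\mathfrak p$ with $T_oM$ through $d\pi_1$. Let $g$ be the $G$-invariant Riemannian metric on $M$ whose value at $o$ is $-B_{\mathfrak g}|_{\mathfrak p\times\mathfrak p}$. Let $R$ be the Riemann curvature tensor of $g$, with the sign for which $R(X,Y,X,Y)$ is the sectional curvature of an orthonormal pair $X,Y$. Give $\bigwedge^2T_oM$ the tensor metric $\langle X\wedge Y,Z\wedge W\rangle=2\bigl(g(X,Z)g(Y,W)-g(X,W)g(Y,Z)\bigr)$, and identify it with $\mathfrak{so}(T_oM,g)$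 through $X\wedge Y\mapsto\bigl(Z\mapsto g(X,Z)Y-g(Y,Z)X\bigr)$. The curvature operator $\mathfrak R$ at $o$ is the linear map $\bigwedge^2T_oM\to\bigwedge^2T_oM$ with $\langle\mathfrak R(X\wedge Y),Z\wedge W\rangle=2R(X,Y,Z,W)$. Then: 1. There is exactly one linear operator $P\colon\mathfrak h\to\mathfrak h$ with $B_{\mathfrak g}(PX,Y)=B_{\mathfrak h}(X,Y)$ for all $X,Y\in\mathfrak h$; there is exactly one linear map $\iota\colon\mathfrak h\to\bigwedge^2T_oM$ for which $\iota(Z)$ corresponds to $\operatorname{ad}_Z|_{\mathfrak p}$ for all $Z\in\mathfrak h$; and the curvature operator $\mathfrak R$ at $o$ exists and is unique. If $\mathfrak h$ contains no nonzero ideal of $\mathfrak g$, then $\iota$ is injective, so that $\mathfrak h$ is identified with $\operatorname{ad}_{\mathfrak h}|_{\mathfrak p}\subset\bigwedge^2T_oM$. 2. Under this identification, $\mathfrak R=\tfrac12(I-P)$ on $\mathfrak h$, that is, $\mathfrak R\circ\iota=\iota\circ\tfrac12(I-P)$, and $\mathfrak R=0$ on the orthogonal complement of $\iota(\mathfrak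 h)$ in $\bigwedge^2T_oM$. -/

import Mathlib

open Bundle Manifold
open scoped ContDiff Manifold Topology

noncomputable section

/-! ### Curvature of a Riemannian manifold -/

section Riemannian

variable {E : Type*} [NormedAddCommGroup E] [NormedSpace ℝ E]
  {M : Type*} [TopologicalSpace M] [ChartedSpace E M] [IsManifold 𝓘(ℝ, E) ∞ M]

/-- Smooth Riemannian metrics on the manifold `M` (without boundary, modelled on `E`). -/
abbrev SmoothMetric (E : Type*) [NormedAddCommGroup E] [NormedSpace ℝ E]
    (M : Type*) [TopologicalSpace M] [ChartedSpace E M] [IsManifold 𝓘(ℝ, E) ∞ M] :=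
  ContMDiffRiemannianMetric 𝓘(ℝ, E) ∞ E (fun x : M ↦ TangentSpace 𝓘(ℝ, E) x)

/-- The scalar product `g_x` on `T_x M`, as a bilinear form. -/
def SmoothMetric.form (g : SmoothMetric E M) (x : M) :
    LinearMap.BilinForm ℝ (TangentSpace 𝓘(ℝ, E) x) :=
  LinearMap.mk₂ ℝ (fun u v ↦ g.inner x u v) (by simp) (by simp) (by simp) (by simp)

/-- The metric read in the preferred chart `φ` at `x`: at a point `y` of the target of `φ`, this is
the bilinear form `(u, v) ↦ g (dφ⁻¹_y u) (dφ⁻¹_y v)` on the model space `E`, that is, the matrix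
`(g_ij(y))` without coordinates. -/
def SmoothMetric.inChart (g : SmoothMetric E M) (x : M) (y : E) : E →L[ℝ] E →L[ℝ] ℝ :=
  let D : E →L[ℝ] E := mfderiv 𝓘(ℝ, E) 𝓘(ℝ, E) (extChartAt 𝓘(ℝ, E) x).symm y
  let B : E →L[ℝ] E →L[ℝ] ℝ := g.inner ((extChartAt 𝓘(ℝ, E) x).symm y)
  B.bilinearComp D D

/-- Christoffel symbols of the first kind of a metric `b` on an open subset of `E`:
`w ↦ ½ (∂_u b(v, w) + ∂_v b(u, w) - ∂_w b(u, v))` at `y`. -/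
def christoffelFirst (b : E → E →L[ℝ] E →L[ℝ] ℝ) (y u v : E) : E →L[ℝ] ℝ :=
  (1 / 2 : ℝ) •
    (fderiv ℝ b y u v + fderiv ℝ b y v u - ((fderiv ℝ b y).flip u).flip v)

/-- Christoffel symbols of the second kind: `Γ_y(u, v)` is the vector with
`b_y(Γ_y(u, v), w) = ½ (∂_u b(v, w) + ∂_v b(u, w) - ∂_w b(u, v))` for all `w`. The Levi-Civita
connection of `b` is `∇_u V = ∂_u V + Γ(u, V)`. -/
def christoffel (b : E → E →L[ℝ] E →L[ℝ] ℝ) (y u v : E) : E :=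
  (b y).inverse (christoffelFirst b y u v)

/-- The curvature endomorphism `R(u, v) w = ∇_u ∇_v w - ∇_v ∇_u w` at `y` (for constant `u, v, w`)
of the metric `b` on an open subset of `E`. -/
def curvatureEndo (b : E → E →L[ℝ] E →L[ℝ] ℝ) (y u v w : E) : E :=
  fderiv ℝ (fun z ↦ christoffel b z v w) y u - fderiv ℝ (fun z ↦ christoffel b z u w) y v
    + christoffel b y u (christoffel b y v w) - christoffel b y v (christoffel b y u w)

/-- The Riemann curvature tensor of `g` at `x`, computed in the preferred chart at `x`, with the
convention `R(X, Y, Z, W) = g(R(X, Y) W, Z)`, so that the sectional curvature of an orthonormal pair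
is `R(X, Y, X, Y)`. -/
def SmoothMetric.riemann (g : SmoothMetric E M) (x : M) (X Y Z W : TangentSpace 𝓘(ℝ, E) x) : ℝ :=
  let φ := extChartAt 𝓘(ℝ, E) x
  let D : E →L[ℝ] E := mfderiv 𝓘(ℝ, E) 𝓘(ℝ, E) φ x
  let b := g.inChart x
  b (φ x) (curvatureEndo b (φ x) (D X) (D Y) (D W)) (D Z)

end Riemannian

/-! ### Bivectors -/

section Bivectors

variable {V : Type*} [AddCommGroup V] [Module ℝ V]

/-- The bivector `X ∧ Y`. -/
def wedge (X Y : V) : ⋀[ℝ]^2 V := exteriorPower.ιMulti ℝ 2 ![X, Y]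

/-- The tensor metric on bivectors:
`⟨X ∧ Y, Z ∧ W⟩ = 2 (b(X, Z) b(Y, W) - b(X, W) b(Y, Z))`, see `bivectorForm_wedge`. -/
def bivectorForm (b : LinearMap.BilinForm ℝ V) : LinearMap.BilinForm ℝ (⋀[ℝ]^2 V) :=
  (2 : ℝ) • (exteriorPower.pairingDual ℝ V 2 ∘ₗ exteriorPower.map 2 b)

theorem bivectorForm_wedge (b : LinearMap.BilinForm ℝ V) (X Y Z W : V) :
    bivectorForm b (wedge X Y) (wedge Z W) = 2 * (b X Z * b Y W - b X W * b Y Z) := by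
  simp [bivectorForm, wedge, Matrix.det_fin_two]
  ring

/-- The linear map `⋀² V → End V` that sends `X ∧ Y` to `Z ↦ b(X, Z) Y - b(Y, Z) X`; for a scalar
product `b` it identifies `⋀² V` with `𝔰𝔬(V, b)`. -/
def bivectorToEnd (b : LinearMap.BilinForm ℝ V) : ⋀[ℝ]^2 V →ₗ[ℝ] Module.End ℝ V :=
  exteriorPower.alternatingMapLinearEquiv
    { toFun := fun v ↦ (b (v 0)).smulRight (v 1) - (b (v 1)).smulRight (v 0)
      map_update_add' := by
        intro _ v i x y
        ext z
        fin_cases i <;> simp [add_smul] <;> abel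
      map_update_smul' := by
        intro _ v i c x
        ext z
        fin_cases i <;> simp [mul_smul, smul_sub, smul_comm c]
      map_eq_zero_of_eq' := by
        intro v i j h hij
        have : v 0 = v 1 := by
          fin_cases i <;> fin_cases j <;> simp_all
        simp [this] }

theorem bivectorToEnd_wedge (b : LinearMap.BilinForm ℝ V) (X Y Z : V) :
    bivectorToEnd b (wedge X Y) Z = b X Z • Y - b Y Z • X := by
  simp [bivectorToEnd, wedge]

end Bivectors

/-- `T` is the curvature operator `⋀² T_x M → ⋀² T_x M` of `g` at `x`:
`⟨T(X ∧ Y), Z ∧ W⟩ = 2 R(X, Y, Z, W)`. -/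
def SmoothMetric.IsCurvatureOperator {E : Type*} [NormedAddCommGroup E] [NormedSpace ℝ E]
    {M : Type*} [TopologicalSpace M] [ChartedSpace E M] [IsManifold 𝓘(ℝ, E) ∞ M]
    (g : SmoothMetric E M) (x : M)
    (T : ⋀[ℝ]^2 (TangentSpace 𝓘(ℝ, E) x) →ₗ[ℝ] ⋀[ℝ]^2 (TangentSpace 𝓘(ℝ, E) x)) : Prop :=
  ∀ X Y Z W : TangentSpace 𝓘(ℝ, E) x,
    bivectorForm (g.form x) (T (wedge X Y)) (wedge Z W) = 2 * g.riemann x X Y Z W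

/-! ### Lie groups and the pair `(𝔤, 𝔥)` -/

section LieGroups

instance instLEInftyMinSmoothness : ENat.LEInfty (minSmoothness ℝ 3) :=
  ⟨by rw [minSmoothness_of_isRCLikeNormedField]; exact ENat.LEInfty.out⟩

variable {E : Type*} [NormedAddCommGroup E] [NormedSpace ℝ E] [CompleteSpace E]
  {G : Type*} [TopologicalSpace G] [ChartedSpace E G] [Group G] [LieGroup 𝓘(ℝ, E) ∞ G]

/-- The Lie algebra of a closed subgroup `K` of a Lie group `G`, as a subalgebra of the Lie algebra
of `G`: the velocities at time `0` of the curves in `K` through `1`. For a closed subgroup these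
velocities already form a Lie subalgebra, so that taking the span adds nothing. -/
def subgroupLieAlgebra (K : Subgroup G) : LieSubalgebra ℝ (GroupLieAlgebra 𝓘(ℝ, E) G) :=
  LieSubalgebra.lieSpan ℝ (GroupLieAlgebra 𝓘(ℝ, E) G)
    {X | ∃ γ : ℝ → G, (∀ t, γ t ∈ K) ∧ γ 0 = 1 ∧ MDifferentiableAt 𝓘(ℝ, ℝ) 𝓘(ℝ, E) γ 0 ∧
      (mfderiv 𝓘(ℝ, ℝ) 𝓘(ℝ, E) γ 0 (1 : ℝ) : E) = X}

/-- The identity component of the fixed point subgroup of `σ`, as a subgroup of `G`. -/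
def fixedIdentityComponent {G : Type*} [TopologicalSpace G] [Group G] [IsTopologicalGroup G]
    (σ : G ≃* G) : Subgroup G :=
  (Subgroup.connectedComponentOfOne (σ.toMonoidHom.eqLocus (MonoidHom.id G))).map
    (Subgroup.subtype _)

/-- The orthogonal complement `𝔭` of a subalgebra `𝔥` for the Killing form of `𝔤`. -/
def killingComplement {L : Type*} [LieRing L] [LieAlgebra ℝ L] (𝔥 : LieSubalgebra ℝ L) :
    Submodule ℝ L :=
  (killingForm ℝ L).orthogonal 𝔥.toSubmodule

/-- `P` is the operator on the subalgebra `𝔥` with `B_𝔤(P X, Y) = B_𝔥(X, Y)`, where `B_𝔤` and `B_𝔥`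
are the Killing forms of `𝔤` and of `𝔥`. -/
def IsKillingRatio {L : Type*} [LieRing L] [LieAlgebra ℝ L] (𝔥 : LieSubalgebra ℝ L)
    (P : 𝔥 →ₗ[ℝ] 𝔥) : Prop :=
  ∀ X Y : 𝔥, killingForm ℝ L (P X : L) (Y : L) = killingForm ℝ 𝔥 X Y

variable {F : Type*} [NormedAddCommGroup F] [NormedSpace ℝ F]

/-- The differential at `1` of the projection `π : G → G ⧸ K`; it sends `X` in the Lie algebra of `G`
to the value at the base point of the action field of `X`. -/
def projDeriv (E F : Type*) [NormedAddCommGroup E] [NormedSpace ℝ E]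
    [NormedAddCommGroup F] [NormedSpace ℝ F]
    {G : Type*} [TopologicalSpace G] [ChartedSpace E G] [Group G]
    (K : Subgroup G) [ChartedSpace F (G ⧸ K)] :
    GroupLieAlgebra 𝓘(ℝ, E) G →L[ℝ] TangentSpace 𝓘(ℝ, F) ((1 : G) : G ⧸ K) :=
  mfderiv 𝓘(ℝ, E) 𝓘(ℝ, F) (fun a : G ↦ (a : G ⧸ K)) 1

/-- `g` is the `G`-invariant Riemannian metric on `G ⧸ K` that is induced by `-B_𝔤`: at the base
point it restricts to `-B_𝔤` on the Killing complement `𝔭` of the Lie algebra of `K`, which is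
identified with the tangent space through action fields. -/
structure IsInducedByKilling (E : Type*) [NormedAddCommGroup E] [NormedSpace ℝ E] [CompleteSpace E]
    {F : Type*} [NormedAddCommGroup F] [NormedSpace ℝ F]
    {G : Type*} [TopologicalSpace G] [ChartedSpace E G] [Group G] [LieGroup 𝓘(ℝ, E) ∞ G]
    (K : Subgroup G) [ChartedSpace F (G ⧸ K)] [IsManifold 𝓘(ℝ, F) ∞ (G ⧸ K)]
    (g : SmoothMetric F (G ⧸ K)) : Prop where
  invariant : ∀ (a : G) (x : G ⧸ K) (u v : TangentSpace 𝓘(ℝ, F) x),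
    g.inner (a • x) (mfderiv 𝓘(ℝ, F) 𝓘(ℝ, F) (fun y : G ⧸ K ↦ a • y) x u)
      (mfderiv 𝓘(ℝ, F) 𝓘(ℝ, F) (fun y : G ⧸ K ↦ a • y) x v) = g.inner x u v
  at_base : ∀ X ∈ killingComplement (subgroupLieAlgebra (E := E) K),
    ∀ Y ∈ killingComplement (subgroupLieAlgebra (E := E) K),
      g.inner ((1 : G) : G ⧸ K) (projDeriv E F K X) (projDeriv E F K Y) =
        - killingForm ℝ (GroupLieAlgebra 𝓘(ℝ, E) G) X Y

/-- `ι` is the map `𝔥 → ⋀² T_o M`, `Z ↦ ad_Z|_𝔭`, where `M = G ⧸ K`, `o` is the base point, `𝔭` is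
identified with `T_o M`, and `⋀² T_o M` with `𝔰𝔬(T_o M, g)`. -/
def IsIsotropyEmbedding {K : Subgroup G} [ChartedSpace F (G ⧸ K)]
    [IsManifold 𝓘(ℝ, F) ∞ (G ⧸ K)] (g : SmoothMetric F (G ⧸ K))
    (ι : subgroupLieAlgebra (E := E) K →ₗ[ℝ]
      ⋀[ℝ]^2 (TangentSpace 𝓘(ℝ, F) ((1 : G) : G ⧸ K))) : Prop :=
  ∀ Z : subgroupLieAlgebra (E := E) K, ∀ X ∈ killingComplement (subgroupLieAlgebra (E := E) K),
    bivectorToEnd (g.form ((1 : G) : G ⧸ K)) (ι Z) (projDeriv E F K X) =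
      projDeriv E F K ⁅(Z : GroupLieAlgebra 𝓘(ℝ, E) G), X⁆

end LieGroups

end

section

set_option maxSynthPendingDepth 3

/-! ### Bivectors and skew endomorphisms -/

section BivectorAlgebra

variable {V : Type*} [AddCommGroup V] [Module ℝ V]

/-! The differential θ of σ at 1 is an involution of 𝔤 that preserves the Killing form B. Its +1
eigenspace is 𝔥 and, B being nondegenerate, its -1 eigenspace is 𝔭. Hence [𝔥, 𝔭] ⊂ 𝔭 and [𝔭, 𝔭] ⊂ 𝔥.
The theorem is the formula R(X, Y, Z, W) = -B([X, Y], [Z, W]) on 𝔭, followed by linear algebra.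

Linear algebra (`IsTangentModel.exists_curvatureOperator`). Let κ : ⋀²𝔭 → 𝔥 send X ∧ Y to [X, Y].
Invariance of B gives ⟨ι Z, β⟩ = -2 B(Z, κ β), so ι and κ are adjoint up to a factor. The curvature
formula then says that the curvature operator is ι ∘ κ, and this vanishes on the orthogonal
complement of ι(𝔥), which is the kernel of κ. Moreover -2 B(Y, κ ι Z) = ⟨ι Y, ι Z⟩ = -tr_𝔭(ad Z ad
Y), and the trace of ad Z ad Y over 𝔭 is B_𝔤(Z, Y) - B_𝔥(Z, Y) (`trace_isotropyAd`). Therefore κ ∘ ι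
= ½(I - P). Finally, the kernel of ι is an ideal of 𝔤.

Curvature (`curvatureEndo_of_killing_family`). Action fields are Killing fields, and their bracket
is minus the action field of the Lie bracket. Fields from 𝔭 have brackets that vanish at o, because
[𝔭, 𝔭] ⊂ 𝔥; by the Koszul formula their covariant derivatives vanish at o
(`apply_fderiv_of_killing`). Killing fields preserve the connection, which fixes their second
derivatives (`IsKillingFieldAt.affine`). It follows that R(A, C)u is the derivative of the bracket
of A and C along u, whence R(X, Y)W = [W, [X, Y]].

All of this is computed in charts, with a local multiplication μ and a local action Φ; the bracket
relations come from differentiating associativity twice. Two geometric inputs remain: the action on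
G/H is smooth, since π has local sections (`contMDiff_quotient_smul`), and 𝔥 is the fixed space of
θ, since σ can be linearised near 1 (`exists_fixed_curve`). -/

theorem wedge_eq_update_left (X Y : V) :
    wedge X Y = exteriorPower.ιMulti ℝ 2 (Function.update ![0, Y] 0 X) := by
  rw [wedge]
  congr 1
  ext i
  fin_cases i <;> rfl

theorem wedge_eq_update_right (X Y : V) :
    wedge X Y = exteriorPower.ιMulti ℝ 2 (Function.update ![X, 0] 1 Y) := by
  rw [wedge]
  congr 1
  ext i
  fin_cases i <;> rfl

theorem wedge_add_left (X X' Y : V) : wedge (X + X') Y = wedge X Y + wedge X' Y := by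
  simp only [wedge_eq_update_left, AlternatingMap.map_update_add]

theorem wedge_smul_left (c : ℝ) (X Y : V) : wedge (c • X) Y = c • wedge X Y := by
  simp only [wedge_eq_update_left, AlternatingMap.map_update_smul]

theorem wedge_add_right (X Y Y' : V) : wedge X (Y + Y') = wedge X Y + wedge X Y' := by
  simp only [wedge_eq_update_right, AlternatingMap.map_update_add]

theorem wedge_smul_right (c : ℝ) (X Y : V) : wedge X (c • Y) = c • wedge X Y := by
  simp only [wedge_eq_update_right, AlternatingMap.map_update_smul]

theorem wedge_self (X : V) : wedge X X = 0 :=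
  (exteriorPower.ιMulti ℝ 2).map_eq_zero_of_eq ![X, X] (i := 0) (j := 1) (by simp) (by simp)

/-- The wedge product of two vectors, as a bilinear map. -/
noncomputable def wedgeBilin (V : Type*) [AddCommGroup V] [Module ℝ V] : V →ₗ[ℝ] V →ₗ[ℝ] ⋀[ℝ]^2 V :=
  LinearMap.mk₂ ℝ wedge wedge_add_left wedge_smul_left wedge_add_right wedge_smul_right

@[simp]
theorem wedgeBilin_apply (X Y : V) : wedgeBilin V X Y = wedge X Y := rfl

theorem wedge_swap (X Y : V) : wedge Y X = -wedge X Y := by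
  have h := wedge_self (X + Y)
  rw [wedge_add_left, wedge_add_right, wedge_add_right, wedge_self, wedge_self, zero_add,
    add_zero] at h
  exact (neg_eq_of_add_eq_zero_right h).symm

theorem bivector_hom_ext {N : Type*} [AddCommGroup N] [Module ℝ N] {f g : ⋀[ℝ]^2 V →ₗ[ℝ] N}
    (h : ∀ X Y : V, f (wedge X Y) = g (wedge X Y)) : f = g := by
  refine exteriorPower.linearMap_ext (AlternatingMap.ext fun v ↦ ?_)
  have hv : v = ![v 0, v 1] := by
    ext i
    fin_cases i <;> rfl
  rw [hv]
  exact h _ _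

/-- The linear map on bivectors induced by an alternating bilinear map. -/
noncomputable def bivectorLift {N : Type*} [AddCommGroup N] [Module ℝ N] (f : V →ₗ[ℝ] V →ₗ[ℝ] N)
    (hf : f.IsAlt) : ⋀[ℝ]^2 V →ₗ[ℝ] N :=
  exteriorPower.alternatingMapLinearEquiv
    { toFun := fun v ↦ f (v 0) (v 1)
      map_update_add' := by
        intro _ v i x y
        fin_cases i <;> simp
      map_update_smul' := by
        intro _ v i c x
        fin_cases i <;> simp
      map_eq_zero_of_eq' := by
        intro v i j h hij
        have : v 0 = v 1 := by
          fin_cases i <;> fin_cases j <;> simp_all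
        rw [this]
        exact hf _ }

theorem bivectorLift_wedge {N : Type*} [AddCommGroup N] [Module ℝ N] (f : V →ₗ[ℝ] V →ₗ[ℝ] N)
    (hf : f.IsAlt) (X Y : V) : bivectorLift f hf (wedge X Y) = f X Y := by
  simp [bivectorLift, wedge]

/-- Reduces every computation with the tensor metric to one with endomorphisms. Both sides are
linear in β, so decomposable β suffice. -/
theorem bivectorForm_apply_wedge (b : LinearMap.BilinForm ℝ V) (β : ⋀[ℝ]^2 V) (Z W : V) :
    bivectorForm b β (wedge Z W) = 2 * b (bivectorToEnd b β Z) W := by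
  have h : LinearMap.flip (bivectorForm b) (wedge Z W) =
      (2 : ℝ) • ((LinearMap.flip b W) ∘ₗ (LinearMap.applyₗ Z) ∘ₗ bivectorToEnd b) := by
    refine bivector_hom_ext fun X Y ↦ ?_
    simp only [LinearMap.flip_apply, bivectorForm_wedge, LinearMap.smul_apply,
      LinearMap.comp_apply, LinearMap.applyₗ_apply_apply, bivectorToEnd_wedge, map_sub, map_smul,
      smul_eq_mul]
    ring
  simpa using LinearMap.congr_fun h β

variable [FiniteDimensional ℝ V]

/-- The bivector `½ ∑ eᵢ ∧ A eⁱ`, for a basis `e` and its dual basis with respect to `b`. On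
endomorphisms that are skew for `b`, this is inverse to `bivectorToEnd`. -/
noncomputable def bivectorOfEnd (b : LinearMap.BilinForm ℝ V) (hb : b.Nondegenerate) :
    Module.End ℝ V →ₗ[ℝ] ⋀[ℝ]^2 V :=
  (1 / 2 : ℝ) • ∑ i, (wedgeBilin V (Module.finBasis ℝ V i)) ∘ₗ
    LinearMap.applyₗ (b.dualBasis hb (Module.finBasis ℝ V) i)

theorem bivectorOfEnd_apply (b : LinearMap.BilinForm ℝ V) (hb : b.Nondegenerate)
    (A : Module.End ℝ V) :
    bivectorOfEnd b hb A = (1 / 2 : ℝ) • ∑ i, wedge (Module.finBasis ℝ V i)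
      (A (b.dualBasis hb (Module.finBasis ℝ V) i)) := by
  simp [bivectorOfEnd]

theorem sum_apply_smul_dualBasis (b : LinearMap.BilinForm ℝ V) (hb : b.Nondegenerate)
    (hsymm : b.IsSymm) (z : V) :
    ∑ i, b (Module.finBasis ℝ V i) z • b.dualBasis hb (Module.finBasis ℝ V) i = z := by
  conv_rhs => rw [← (b.dualBasis hb (Module.finBasis ℝ V)).sum_repr z]
  refine Finset.sum_congr rfl fun i _ ↦ ?_
  rw [LinearMap.BilinForm.dualBasis_repr_apply, hsymm.eq]

theorem apply_dualBasis_eq_repr (b : LinearMap.BilinForm ℝ V) (hb : b.Nondegenerate) (z : V)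
    (i : Fin (Module.finrank ℝ V)) :
    b (b.dualBasis hb (Module.finBasis ℝ V) i) z = (Module.finBasis ℝ V).repr z i := by
  have h := congrArg (b (b.dualBasis hb (Module.finBasis ℝ V) i))
    ((Module.finBasis ℝ V).sum_repr z)
  rw [← h]
  simp only [map_sum, map_smul, smul_eq_mul, LinearMap.BilinForm.apply_dualBasis_left]
  simp

theorem sum_dualBasis_apply_smul (b : LinearMap.BilinForm ℝ V) (hb : b.Nondegenerate) (z : V) :
    ∑ i, b (b.dualBasis hb (Module.finBasis ℝ V) i) z • Module.finBasis ℝ V i = z := by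
  simp only [apply_dualBasis_eq_repr, (Module.finBasis ℝ V).sum_repr]

theorem trace_eq_sum_dualBasis (b : LinearMap.BilinForm ℝ V) (hb : b.Nondegenerate)
    (A : Module.End ℝ V) :
    LinearMap.trace ℝ V A = ∑ i, b (b.dualBasis hb (Module.finBasis ℝ V) i)
      (A (Module.finBasis ℝ V i)) := by
  rw [LinearMap.trace_eq_matrix_trace ℝ (Module.finBasis ℝ V), Matrix.trace]
  refine Finset.sum_congr rfl fun i _ ↦ ?_
  rw [Matrix.diag_apply, LinearMap.toMatrix_apply, apply_dualBasis_eq_repr]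

/-- By skewness, eᵢ ∧ A eⁱ acts as z ↦ b(eᵢ, z) A eⁱ + b(eⁱ, A z) eᵢ. Each of the two sums over i
equals A z, which accounts for the factor ½. -/
theorem bivectorToEnd_bivectorOfEnd (b : LinearMap.BilinForm ℝ V) (hb : b.Nondegenerate)
    (hsymm : b.IsSymm) (A : Module.End ℝ V) (hA : ∀ x y, b (A x) y = -b x (A y)) :
    bivectorToEnd b (bivectorOfEnd b hb A) = A := by
  ext z
  have h1 : ∑ i, b (Module.finBasis ℝ V i) z • A (b.dualBasis hb (Module.finBasis ℝ V) i) =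
      A z := by
    conv_rhs => rw [← sum_apply_smul_dualBasis b hb hsymm z]
    simp [map_sum]
  have h2 := sum_dualBasis_apply_smul b hb (A z)
  simp only [bivectorOfEnd_apply, map_smul, map_sum, LinearMap.smul_apply, LinearMap.sum_apply,
    bivectorToEnd_wedge, hA, neg_smul, sub_neg_eq_add, Finset.sum_add_distrib, h1, h2]
  rw [← two_smul ℝ (A z), smul_smul]
  norm_num

theorem bivectorOfEnd_bivectorToEnd (b : LinearMap.BilinForm ℝ V) (hb : b.Nondegenerate)
    (hsymm : b.IsSymm) (β : ⋀[ℝ]^2 V) : bivectorOfEnd b hb (bivectorToEnd b β) = β := by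
  have h : bivectorOfEnd b hb ∘ₗ bivectorToEnd b = LinearMap.id := by
    refine bivector_hom_ext fun X Y ↦ ?_
    have key : ∀ P Q : V, ∑ i, b P (b.dualBasis hb (Module.finBasis ℝ V) i) •
        wedge (Module.finBasis ℝ V i) Q = wedge P Q := by
      intro P Q
      conv_rhs => rw [← sum_dualBasis_apply_smul b hb P, ← wedgeBilin_apply]
      simp [map_sum, hsymm.eq P]
    simp only [LinearMap.comp_apply, bivectorOfEnd_apply, bivectorToEnd_wedge,
      LinearMap.id_apply]
    simp only [← wedgeBilin_apply, map_sub, map_smul, Finset.sum_sub_distrib]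
    simp only [wedgeBilin_apply, key, wedge_swap X Y, sub_neg_eq_add]
    rw [← two_smul ℝ (wedge X Y), smul_smul]
    norm_num
  exact LinearMap.congr_fun h β

theorem bivectorToEnd_injective (b : LinearMap.BilinForm ℝ V) (hb : b.Nondegenerate)
    (hsymm : b.IsSymm) : Function.Injective (bivectorToEnd b) :=
  Function.LeftInverse.injective (bivectorOfEnd_bivectorToEnd b hb hsymm)

/-- Nondegeneracy of the tensor metric, tested on decomposable bivectors only; the defining property
of the curvature operator gives no more. -/
theorem bivector_ext_of_form_wedge (b : LinearMap.BilinForm ℝ V) (hb : b.Nondegenerate)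
    (hsymm : b.IsSymm) {β β' : ⋀[ℝ]^2 V}
    (h : ∀ Z W, bivectorForm b β (wedge Z W) = bivectorForm b β' (wedge Z W)) : β = β' := by
  refine bivectorToEnd_injective b hb hsymm (LinearMap.ext fun Z ↦ ?_)
  refine sub_eq_zero.mp (hb.1 _ fun W ↦ ?_)
  have := h Z W
  rw [bivectorForm_apply_wedge, bivectorForm_apply_wedge] at this
  rw [map_sub, LinearMap.sub_apply]
  linarith

end BivectorAlgebra

/-! ### Symmetric pairs of Lie algebras -/

section SymmetricPairs

variable {L : Type*} [LieRing L] [LieAlgebra ℝ L]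

/-- `(𝔤, 𝔥)` is the symmetric pair of the involution `θ` of `𝔤`. -/
structure IsSymmetricPair (θ : L ≃ₗ⁅ℝ⁆ L) (𝔥 : LieSubalgebra ℝ L) : Prop where
  involutive : ∀ X, θ (θ X) = X
  mem_iff : ∀ X, X ∈ 𝔥 ↔ θ X = X

namespace IsSymmetricPair

variable {θ : L ≃ₗ⁅ℝ⁆ L} {𝔥 : LieSubalgebra ℝ L}

theorem add_mem (h : IsSymmetricPair θ 𝔥) (X : L) : X + θ X ∈ 𝔥 := by
  rw [h.mem_iff, map_add, h.involutive, add_comm]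

theorem lie_mem (h : IsSymmetricPair θ 𝔥) {X Y : L} (hX : θ X = -X) (hY : θ Y = -Y) :
    ⁅X, Y⁆ ∈ 𝔥 := by
  rw [h.mem_iff, LieEquiv.map_lie, hX, hY, lie_neg, neg_lie, neg_neg]

theorem lie_neg_of_mem (h : IsSymmetricPair θ 𝔥) {Z X : L} (hZ : Z ∈ 𝔥) (hX : θ X = -X) :
    θ ⁅Z, X⁆ = -⁅Z, X⁆ := by
  rw [LieEquiv.map_lie, (h.mem_iff Z).mp hZ, hX, lie_neg]

theorem killingForm_eq_zero (h : IsSymmetricPair θ 𝔥) {Z X : L} (hZ : Z ∈ 𝔥)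
    (hX : θ X = -X) : killingForm ℝ L Z X = 0 := by
  have := LieAlgebra.killingForm_of_equiv_apply θ Z X
  rw [(h.mem_iff Z).mp hZ, hX, map_neg] at this
  linarith

variable [LieAlgebra.IsKilling ℝ L]

theorem eq_zero_of_killingForm {X : L} (hX : ∀ Y, killingForm ℝ L X Y = 0) : X = 0 :=
  (LieAlgebra.IsKilling.killingForm_nondegenerate ℝ L).1 X hX

/-- B is nondegenerate on 𝔥: any Y is half the sum of Y + θY in 𝔥 and Y - θY, which is orthogonal to
𝔥. -/
theorem mem_eq_zero (h : IsSymmetricPair θ 𝔥) {X : L} (hX : X ∈ 𝔥)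
    (hX0 : ∀ Y ∈ 𝔥, killingForm ℝ L X Y = 0) : X = 0 := by
  refine eq_zero_of_killingForm fun Y ↦ ?_
  have h1 := hX0 _ (h.add_mem Y)
  have h2 : killingForm ℝ L X (Y - θ Y) = 0 :=
    h.killingForm_eq_zero hX (by rw [map_sub, h.involutive, neg_sub])
  rw [map_add] at h1
  rw [map_sub] at h2
  linarith

theorem neg_eq_zero (h : IsSymmetricPair θ 𝔥) {X : L} (hX : θ X = -X)
    (hX0 : ∀ Y, θ Y = -Y → killingForm ℝ L X Y = 0) : X = 0 := by
  refine eq_zero_of_killingForm fun Y ↦ ?_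
  have h1 := h.killingForm_eq_zero (h.add_mem Y) hX
  have h2 := hX0 (Y - θ Y) (by rw [map_sub, h.involutive, neg_sub])
  rw [LieModule.traceForm_comm, map_add] at h1
  rw [map_sub] at h2
  linarith

/-- If X is orthogonal to 𝔥, so is θX, because θ preserves B and fixes 𝔥. Then X + θX lies in 𝔥 and
is orthogonal to it, hence is 0. -/
theorem mem_killingComplement_iff (h : IsSymmetricPair θ 𝔥) (X : L) :
    X ∈ killingComplement 𝔥 ↔ θ X = -X := by
  constructor
  · intro hX
    have hX' : ∀ Y ∈ 𝔥, killingForm ℝ L Y X = 0 := fun Y hY ↦ hX Y hY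
    have h0 : X + θ X = 0 := by
      refine h.mem_eq_zero (h.add_mem X) fun Y hY ↦ ?_
      have h1 := LieAlgebra.killingForm_of_equiv_apply θ Y X
      rw [(h.mem_iff Y).mp hY] at h1
      rw [LieModule.traceForm_comm, map_add, h1, hX' Y hY, add_zero]
    exact (neg_eq_of_add_eq_zero_right h0).symm
  · intro hX Y hY
    exact h.killingForm_eq_zero hY hX

variable [FiniteDimensional ℝ L]

/-- B_𝔤 restricted to 𝔥 is nondegenerate, so P is the inverse of its duality map applied after B_𝔥.
-/
theorem existsUnique_killingRatio (h : IsSymmetricPair θ 𝔥) :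
    ∃ P : 𝔥 →ₗ[ℝ] 𝔥, IsKillingRatio 𝔥 P ∧ ∀ P', IsKillingRatio 𝔥 P' → P' = P := by
  let B : LinearMap.BilinForm ℝ 𝔥 :=
    (killingForm ℝ L).domRestrict₁₂ 𝔥.toSubmodule 𝔥.toSubmodule
  have hBapp : ∀ X Y : 𝔥, B X Y = killingForm ℝ L (X : L) (Y : L) := fun _ _ ↦ rfl
  have hB0 : ∀ X : 𝔥, (∀ Y, B X Y = 0) → X = 0 := by
    intro X hX
    have := h.mem_eq_zero X.2 fun Y hY ↦ hX ⟨Y, hY⟩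
    exact Subtype.ext this
  have hB : B.Nondegenerate := by
    refine ⟨hB0, fun Y hY ↦ hB0 Y fun X ↦ ?_⟩
    rw [hBapp, LieModule.traceForm_comm]
    exact hY X
  refine ⟨(B.toDual hB).symm.toLinearMap ∘ₗ killingForm ℝ 𝔥, fun X Y ↦ ?_, fun P' hP' ↦ ?_⟩
  · rw [← hBapp]
    exact LinearMap.BilinForm.apply_toDual_symm_apply (hB := hB) (killingForm ℝ 𝔥 X) Y
  · refine LinearMap.ext fun X ↦ sub_eq_zero.mp (hB0 _ fun Y ↦ ?_)
    rw [map_sub, LinearMap.sub_apply, hBapp, hP' X Y, sub_eq_zero]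
    exact (LinearMap.BilinForm.apply_toDual_symm_apply (hB := hB) (killingForm ℝ 𝔥 X) Y).symm

end IsSymmetricPair

variable {V : Type*} [AddCommGroup V] [Module ℝ V]

/-- The `-1` eigenspace of `θ` is identified with a space `V` with scalar product `b`, in such a way
that `b` corresponds to the negative of the Killing form: `pr` is the projection to `V` and `s` the
inclusion of `V`. -/
structure IsTangentModel (θ : L ≃ₗ⁅ℝ⁆ L) (b : LinearMap.BilinForm ℝ V) (pr : L →ₗ[ℝ] V)
    (s : V →ₗ[ℝ] L) : Prop where
  map_incl : ∀ v, θ (s v) = -s v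
  proj_incl : ∀ v, pr (s v) = v
  incl_proj : ∀ X, (2 : ℝ) • s (pr X) = X - θ X
  form_eq : ∀ v w, b v w = -killingForm ℝ L (s v) (s w)

namespace IsTangentModel

variable {θ : L ≃ₗ⁅ℝ⁆ L} {𝔥 : LieSubalgebra ℝ L} {b : LinearMap.BilinForm ℝ V}
  {pr : L →ₗ[ℝ] V} {s : V →ₗ[ℝ] L}

theorem incl_proj_of_neg (H : IsTangentModel θ b pr s) {X : L} (hX : θ X = -X) :
    s (pr X) = X := by
  have h1 := H.incl_proj X
  rw [hX, sub_neg_eq_add, ← two_smul ℝ X] at h1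
  exact smul_right_injective L (two_ne_zero' ℝ) h1

theorem proj_of_mem (h : IsSymmetricPair θ 𝔥) (H : IsTangentModel θ b pr s) {X : L}
    (hX : X ∈ 𝔥) : pr X = 0 := by
  have h1 := H.incl_proj X
  rw [(h.mem_iff X).mp hX, sub_self, smul_eq_zero_iff_right (two_ne_zero' ℝ)] at h1
  rw [← H.proj_incl (pr X), h1, map_zero]

theorem isSymm (H : IsTangentModel θ b pr s) : b.IsSymm :=
  ⟨fun v w ↦ by rw [H.form_eq, H.form_eq, LieModule.traceForm_comm]⟩

/-- The endomorphism of `V` that corresponds to `ad Z` on the `-1` eigenspace of `θ`. -/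
noncomputable def isotropyAd (pr : L →ₗ[ℝ] V) (s : V →ₗ[ℝ] L) : L →ₗ[ℝ] Module.End ℝ V where
  toFun Z := pr ∘ₗ (LieAlgebra.ad ℝ L Z : L →ₗ[ℝ] L) ∘ₗ s
  map_add' Z Z' := by
    ext v
    simp
  map_smul' c Z := by
    ext v
    simp

theorem isotropyAd_apply (Z : L) (v : V) : isotropyAd pr s Z v = pr ⁅Z, s v⁆ := rfl

theorem incl_isotropyAd (h : IsSymmetricPair θ 𝔥) (H : IsTangentModel θ b pr s) {Z : L}
    (hZ : Z ∈ 𝔥) (v : V) : s (isotropyAd pr s Z v) = ⁅Z, s v⁆ :=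
  H.incl_proj_of_neg (h.lie_neg_of_mem hZ (H.map_incl v))

theorem isotropyAd_form (h : IsSymmetricPair θ 𝔥) (H : IsTangentModel θ b pr s) {Z : L}
    (hZ : Z ∈ 𝔥) (v w : V) :
    b (isotropyAd pr s Z v) w = -killingForm ℝ L Z ⁅s v, s w⁆ := by
  rw [H.form_eq, incl_isotropyAd h H hZ, LieModule.traceForm_apply_lie_apply]

theorem isotropyAd_skew (h : IsSymmetricPair θ 𝔥) (H : IsTangentModel θ b pr s) {Z : L}
    (hZ : Z ∈ 𝔥) (v w : V) :
    b (isotropyAd pr s Z v) w = -b v (isotropyAd pr s Z w) := by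
  rw [← H.isSymm.eq (isotropyAd pr s Z w) v, isotropyAd_form h H hZ,
    isotropyAd_form h H hZ, ← lie_skew (s v) (s w), map_neg, neg_neg]

/-- For Z, Y in 𝔥 the map ad Z ad Y preserves 𝔥 ⊕ 𝔭. Its trace over 𝔤 is B_𝔤, its trace over 𝔥 is
B_𝔥, and the block on 𝔭 is what remains. -/
theorem trace_isotropyAd (h : IsSymmetricPair θ 𝔥) (H : IsTangentModel θ b pr s)
    [FiniteDimensional ℝ L]
    [FiniteDimensional ℝ V] (Z Y : 𝔥) :
    LinearMap.trace ℝ V (isotropyAd pr s (Z : L) ∘ₗ isotropyAd pr s (Y : L)) =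
      killingForm ℝ L (Z : L) (Y : L) - killingForm ℝ 𝔥 Z Y := by
  let q : L →ₗ[ℝ] 𝔥 := LinearMap.codRestrict 𝔥.toSubmodule
    ((1 / 2 : ℝ) • (LinearMap.id + (θ : L →ₗ[ℝ] L)))
    (fun X ↦ 𝔥.smul_mem _ (h.add_mem X))
  let f : L →ₗ[ℝ] L := LieAlgebra.ad ℝ L (Z : L) ∘ₗ LieAlgebra.ad ℝ L (Y : L)
  have hq : ∀ X : L, ((q X : 𝔥) : L) = (1 / 2 : ℝ) • (X + θ X) := fun X ↦ rfl
  have hqh : ∀ X : 𝔥, q (X : L) = X := by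
    intro X
    refine Subtype.ext ?_
    rw [hq, (h.mem_iff _).mp X.2, ← two_smul ℝ (X : L), smul_smul]
    norm_num
  -- The projections to 𝔥 and to 𝔭 add up to the identity. Cyclicity of the trace then moves each
  -- summand to an endomorphism of 𝔥 or of V.
  have h1 : f = f ∘ₗ 𝔥.toSubmodule.subtype ∘ₗ q + f ∘ₗ s ∘ₗ pr := by
    ext X
    have h2 : (q X : L) + s (pr X) = X := by
      have h3 : s (pr X) = (1 / 2 : ℝ) • (X - θ X) := by
        rw [← H.incl_proj X, smul_smul]
        norm_num
      rw [hq, h3]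
      module
    change f X = f (q X : L) + f (s (pr X))
    rw [← map_add, h2]
  have h4 : LinearMap.trace ℝ L (f ∘ₗ 𝔥.toSubmodule.subtype ∘ₗ q) = killingForm ℝ 𝔥 Z Y := by
    rw [← LinearMap.comp_assoc, LinearMap.trace_comp_comm', LieModule.traceForm_apply_apply]
    congr 1
    ext X
    change ((q ⁅(Z : L), ⁅(Y : L), (X : L)⁆⁆ : 𝔥) : L) = ((⁅Z, ⁅Y, X⁆⁆ : 𝔥) : L)
    rw [← hqh ⁅Z, ⁅Y, X⁆⁆]
    rfl
  have h5 : LinearMap.trace ℝ L (f ∘ₗ s ∘ₗ pr) =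
      LinearMap.trace ℝ V (isotropyAd pr s (Z : L) ∘ₗ isotropyAd pr s (Y : L)) := by
    rw [← LinearMap.comp_assoc, LinearMap.trace_comp_comm']
    congr 1
    ext v
    change pr ⁅(Z : L), ⁅(Y : L), s v⁆⁆ = pr ⁅(Z : L), s (isotropyAd pr s (Y : L) v)⁆
    rw [incl_isotropyAd h H Y.2]
  have h6 : killingForm ℝ L (Z : L) (Y : L) = LinearMap.trace ℝ L f := rfl
  rw [h6, h1, map_add, h4, h5]
  ring

variable [LieAlgebra.IsKilling ℝ L]

theorem nondegenerate (h : IsSymmetricPair θ 𝔥) (H : IsTangentModel θ b pr s) :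
    b.Nondegenerate := by
  have key : ∀ v, (∀ w, b v w = 0) → v = 0 := by
    intro v hv
    have h0 : s v = 0 := by
      refine h.neg_eq_zero (H.map_incl v) fun Y hY ↦ ?_
      have h2 := hv (pr Y)
      rwa [H.form_eq, H.incl_proj_of_neg hY, neg_eq_zero] at h2
    rw [← H.proj_incl v, h0, map_zero]
  refine ⟨key, fun w hw ↦ key w fun v ↦ ?_⟩
  rw [H.isSymm.eq]
  exact hw v

/-- The purely algebraic half of the theorem: geometry enters only through the formula `hriem` for
the curvature tensor. -/
theorem exists_curvatureOperator [FiniteDimensional ℝ L] [FiniteDimensional ℝ V]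
    (h : IsSymmetricPair θ 𝔥) (H : IsTangentModel θ b pr s) (riem : V → V → V → V → ℝ)
    (hriem : ∀ X Y Z W, riem X Y Z W = -killingForm ℝ L ⁅s X, s Y⁆ ⁅s Z, s W⁆) :
    ∃ (ι : 𝔥 →ₗ[ℝ] ⋀[ℝ]^2 V) (P : 𝔥 →ₗ[ℝ] 𝔥) (T : ⋀[ℝ]^2 V →ₗ[ℝ] ⋀[ℝ]^2 V),
      ((∀ Z : 𝔥, ∀ X ∈ killingComplement 𝔥,
          bivectorToEnd b (ι Z) (pr X) = pr ⁅(Z : L), X⁆) ∧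
        ∀ ι' : 𝔥 →ₗ[ℝ] ⋀[ℝ]^2 V, (∀ Z : 𝔥, ∀ X ∈ killingComplement 𝔥,
          bivectorToEnd b (ι' Z) (pr X) = pr ⁅(Z : L), X⁆) → ι' = ι) ∧
      (IsKillingRatio 𝔥 P ∧ ∀ P', IsKillingRatio 𝔥 P' → P' = P) ∧
      ((∀ X Y Z W, bivectorForm b (T (wedge X Y)) (wedge Z W) = 2 * riem X Y Z W) ∧
        ∀ T' : ⋀[ℝ]^2 V →ₗ[ℝ] ⋀[ℝ]^2 V,
          (∀ X Y Z W, bivectorForm b (T' (wedge X Y)) (wedge Z W) = 2 * riem X Y Z W) →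
            T' = T) ∧
      ((∀ J : LieIdeal ℝ L, (∀ X ∈ J, X ∈ 𝔥) → J = ⊥) → Function.Injective ι) ∧
      T ∘ₗ ι = ι ∘ₗ ((1 / 2 : ℝ) • (LinearMap.id - P)) ∧
      (∀ β, (∀ Z, bivectorForm b (ι Z) β = 0) → T β = 0) := by
  have hb := nondegenerate h H
  have hs := H.isSymm
  obtain ⟨P, hP, hPuniq⟩ := h.existsUnique_killingRatio
  let ι : 𝔥 →ₗ[ℝ] ⋀[ℝ]^2 V :=
    bivectorOfEnd b hb ∘ₗ isotropyAd pr s ∘ₗ 𝔥.toSubmodule.subtype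
  -- The bracket 𝔭 × 𝔭 → 𝔥, whose extension κ to bivectors is the adjoint of ι up to the factor -2.
  let κ₀ : V →ₗ[ℝ] V →ₗ[ℝ] 𝔥 := LinearMap.mk₂ ℝ
    (fun v w ↦ (⟨⁅s v, s w⁆, h.lie_mem (H.map_incl v) (H.map_incl w)⟩ : 𝔥))
    (by intros; apply Subtype.ext; simp) (by intros; apply Subtype.ext; simp)
    (by intros; apply Subtype.ext; simp) (by intros; apply Subtype.ext; simp)
  let κ : ⋀[ℝ]^2 V →ₗ[ℝ] 𝔥 := bivectorLift κ₀ fun v ↦ Subtype.ext (lie_self (s v))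
  have hκ : ∀ v w, ((κ (wedge v w) : 𝔥) : L) = ⁅s v, s w⁆ := by
    intro v w
    rw [show κ (wedge v w) = κ₀ v w from bivectorLift_wedge _ _ _ _]
    rfl
  have hι : ∀ Z : 𝔥, bivectorToEnd b (ι Z) = isotropyAd pr s (Z : L) := fun Z ↦
    bivectorToEnd_bivectorOfEnd b hb hs _ (isotropyAd_skew h H Z.2)
  have hιform : ∀ (Z : 𝔥) (β : ⋀[ℝ]^2 V),
      bivectorForm b (ι Z) β = -2 * killingForm ℝ L (Z : L) (κ β : L) := by
    intro Z β
    have h1 : bivectorForm b (ι Z) =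
        (-2 : ℝ) • (killingForm ℝ L (Z : L) ∘ₗ 𝔥.toSubmodule.subtype ∘ₗ κ) := by
      refine bivector_hom_ext fun X Y ↦ ?_
      rw [bivectorForm_apply_wedge, hι, isotropyAd_form h H Z.2]
      change _ = (-2 : ℝ) * killingForm ℝ L (Z : L) ((κ (wedge X Y) : 𝔥) : L)
      rw [hκ]
      ring
    rw [h1]
    rfl
  have hT : ∀ X Y Z W, bivectorForm b ((ι ∘ₗ κ) (wedge X Y)) (wedge Z W) =
      2 * riem X Y Z W := by
    intro X Y Z W
    rw [LinearMap.comp_apply, hιform, hκ, hκ, hriem]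
    ring
  refine ⟨ι, P, ι ∘ₗ κ, ⟨?_, ?_⟩, ⟨hP, hPuniq⟩, ⟨hT, ?_⟩, ?_, ?_, ?_⟩
  · intro Z X hX
    rw [hι, isotropyAd_apply, H.incl_proj_of_neg ((h.mem_killingComplement_iff X).mp hX)]
  · intro ι' hι'
    refine LinearMap.ext fun Z ↦ bivectorToEnd_injective b hb hs (LinearMap.ext fun v ↦ ?_)
    have h1 := hι' Z (s v) ((h.mem_killingComplement_iff _).mpr (H.map_incl v))
    rwa [H.proj_incl, ← isotropyAd_apply, ← hι] at h1
  · intro T' hT'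
    refine bivector_hom_ext fun X Y ↦ bivector_ext_of_form_wedge b hb hs fun Z W ↦ ?_
    rw [hT', hT]
  · intro hJ
    -- The centraliser of 𝔭 in 𝔥, that is, the kernel of ι. Bracketing with 𝔭 kills it, and
    -- bracketing with 𝔥 preserves it by the Jacobi identity and [𝔥, 𝔭] ⊂ 𝔭.
    let J : LieIdeal ℝ L :=
      { carrier := {Z | Z ∈ 𝔥 ∧ ∀ v, ⁅Z, s v⁆ = 0}
        add_mem' := fun {Z Z'} hZ hZ' ↦ ⟨𝔥.add_mem hZ.1 hZ'.1, fun v ↦ by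
          rw [add_lie, hZ.2, hZ'.2, add_zero]⟩
        zero_mem' := ⟨𝔥.zero_mem, fun v ↦ zero_lie _⟩
        smul_mem' := fun c Z hZ ↦ ⟨𝔥.smul_mem c hZ.1, fun v ↦ by
          rw [smul_lie, hZ.2, smul_zero]⟩
        lie_mem := fun {X Z} hZ ↦ by
          have hX : X = (1 / 2 : ℝ) • (X + θ X) + s (pr X) := by
            have h3 : s (pr X) = (1 / 2 : ℝ) • (X - θ X) := by
              rw [← H.incl_proj X, smul_smul]
              norm_num
            rw [h3]
            module
          have hY : (1 / 2 : ℝ) • (X + θ X) ∈ 𝔥 := 𝔥.smul_mem _ (h.add_mem X)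
          have h4 : ⁅X, Z⁆ = ⁅(1 / 2 : ℝ) • (X + θ X), Z⁆ := by
            conv_lhs => rw [hX]
            rw [add_lie, ← lie_skew (s (pr X)) Z, hZ.2, neg_zero, add_zero]
          change ⁅X, Z⁆ ∈ 𝔥 ∧ ∀ v, ⁅⁅X, Z⁆, s v⁆ = 0
          rw [h4]
          refine ⟨𝔥.lie_mem hY hZ.1, fun v ↦ ?_⟩
          rw [lie_lie, hZ.2, lie_zero, ← incl_isotropyAd h H hY, hZ.2, sub_zero] }
    have hJ0 := hJ J fun X hX ↦ hX.1
    rw [injective_iff_map_eq_zero]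
    intro Z hZ
    have hZJ : (Z : L) ∈ J := by
      refine ⟨Z.2, fun v ↦ ?_⟩
      rw [← incl_isotropyAd h H Z.2, ← hι, hZ, map_zero, LinearMap.zero_apply, map_zero]
    rw [hJ0] at hZJ
    exact Subtype.ext hZJ
  · have h1 : κ ∘ₗ ι = (1 / 2 : ℝ) • (LinearMap.id - P) := by
      refine LinearMap.ext fun Z ↦ sub_eq_zero.mp (Subtype.ext ?_)
      refine h.mem_eq_zero (SetLike.coe_mem _) fun Y hY ↦ ?_
      have h2 := hιform ⟨Y, hY⟩ (ι Z)
      -- Expanding ι Z as ½ ∑ eᵢ ∧ (ad Z) eⁱ gives ∑ b((ad Y) eᵢ, (ad Z) eⁱ), and skewness of ad Z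
      -- turns this into -tr(ad Z ad Y).
      have h3 : bivectorForm b (ι ⟨Y, hY⟩) (ι Z) =
          -LinearMap.trace ℝ V (isotropyAd pr s (Z : L) ∘ₗ isotropyAd pr s Y) := by
        conv_lhs =>
          enter [2]
          change bivectorOfEnd b hb (isotropyAd pr s (Z : L))
        rw [bivectorOfEnd_apply, map_smul, map_sum, trace_eq_sum_dualBasis b hb,
          ← Finset.sum_neg_distrib, Finset.smul_sum]
        refine Finset.sum_congr rfl fun i _ ↦ ?_
        rw [bivectorForm_apply_wedge, hι, LinearMap.comp_apply,
          ← hs.eq (isotropyAd pr s (Z : L) _), isotropyAd_skew h H Z.2, smul_eq_mul]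
        ring
      rw [h3, trace_isotropyAd h H Z ⟨Y, hY⟩, LieModule.traceForm_comm] at h2
      have h4 := hP Z ⟨Y, hY⟩
      have h5 : (((κ ∘ₗ ι) Z - ((1 / 2 : ℝ) • (LinearMap.id - P) : 𝔥 →ₗ[ℝ] 𝔥) Z : 𝔥) : L) =
          (κ (ι Z) : L) - (1 / 2 : ℝ) • ((Z : L) - (P Z : L)) := rfl
      have h6 := LieModule.traceForm_comm ℝ L L Y (κ (ι Z) : L)
      have h7 := LieModule.traceForm_comm ℝ L L Y (Z : L)
      simp only at h2 h4
      rw [h5]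
      simp only [map_sub, map_smul, LinearMap.sub_apply, LinearMap.smul_apply, smul_eq_mul, h4]
      linarith
    rw [LinearMap.comp_assoc, h1]
  · intro β hβ
    -- By the adjunction, orthogonality to ι(𝔥) says that κ β is B-orthogonal to 𝔥.
    have h1 : κ β = 0 := by
      refine Subtype.ext (h.mem_eq_zero (SetLike.coe_mem _) fun Y hY ↦ ?_)
      have h2 := hβ ⟨Y, hY⟩
      rw [hιform] at h2
      rw [LieModule.traceForm_comm]
      linarith
    rw [LinearMap.comp_apply, h1, map_zero]

end IsTangentModel

end SymmetricPairs

/-! ### Killing fields of a metric on an open subset of a vector space -/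

section KillingFields

variable {F : Type*} [NormedAddCommGroup F] [NormedSpace ℝ F]

/-- The vector field `A` satisfies the Killing equation for the metric `b` near `y`. -/
noncomputable def IsKillingFieldAt (b : F → F →L[ℝ] F →L[ℝ] ℝ) (A : F → F) (y : F) : Prop :=
  ∀ᶠ z in 𝓝 y, ∀ u v,
    fderiv ℝ b z (A z) u v + b z (fderiv ℝ A z u) v + b z u (fderiv ℝ A z v) = 0

theorem christoffelFirst_apply (b : F → F →L[ℝ] F →L[ℝ] ℝ) (y u v w : F) :
    christoffelFirst b y u v w =
      1 / 2 * (fderiv ℝ b y u v w + fderiv ℝ b y v u w - fderiv ℝ b y w u v) := by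
  simp [christoffelFirst]

theorem apply_christoffel {b : F → F →L[ℝ] F →L[ℝ] ℝ} {y : F} (hinv : (b y).IsInvertible)
    (u v w : F) : b y (christoffel b y u v) w =
      1 / 2 * (fderiv ℝ b y u v w + fderiv ℝ b y v u w - fderiv ℝ b y w u v) := by
  rw [christoffel, hinv.self_apply_inverse, christoffelFirst_apply]

theorem christoffel_neg_left (b : F → F →L[ℝ] F →L[ℝ] ℝ) (y u v : F) :
    christoffel b y (-u) v = -christoffel b y u v := by
  rw [christoffel, christoffel, ← map_neg]
  congr 1
  ext w
  simp only [christoffelFirst_apply, map_neg, neg_apply]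
  ring

theorem christoffel_neg_right (b : F → F →L[ℝ] F →L[ℝ] ℝ) (y u v : F) :
    christoffel b y u (-v) = -christoffel b y u v := by
  rw [christoffel, christoffel, ← map_neg]
  congr 1
  ext w
  simp only [christoffelFirst_apply, map_neg, neg_apply]
  ring

/-- Two-variable functions with symmetric values have symmetric derivatives. -/
theorem fderiv_apply_symm {b : F → F →L[ℝ] F →L[ℝ] ℝ} {y : F} (hb : DifferentiableAt ℝ b y)
    (hsymm : ∀ᶠ z in 𝓝 y, ∀ u v, b z u v = b z v u) (w u v : F) :
    fderiv ℝ b y w u v = fderiv ℝ b y w v u := by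
  have h : ∀ u v, HasFDerivAt (fun z ↦ b z u v) _ y := fun u v ↦
    (hb.hasFDerivAt.clm_apply (hasFDerivAt_const u y)).clm_apply (hasFDerivAt_const v y)
  have h1 := ((h u v).congr_of_eventuallyEq (f₁ := fun z ↦ b z v u)
    (hsymm.mono fun z hz ↦ hz v u)).unique (h v u)
  simpa using congrArg (fun f : F →L[ℝ] ℝ ↦ f w) h1

theorem christoffel_symm {b : F → F →L[ℝ] F →L[ℝ] ℝ} {y : F} (hb : DifferentiableAt ℝ b y)
    (hsymm : ∀ᶠ z in 𝓝 y, ∀ u v, b z u v = b z v u) (u v : F) :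
    christoffel b y u v = christoffel b y v u := by
  rw [christoffel, christoffel]
  congr 1
  ext w
  rw [christoffelFirst_apply, christoffelFirst_apply, fderiv_apply_symm hb hsymm w u v]
  ring

theorem differentiableAt_christoffel [CompleteSpace F] {b : F → F →L[ℝ] F →L[ℝ] ℝ} {y : F}
    (hb : ContDiffAt ℝ ∞ b y) (hinv : (b y).IsInvertible) (u v : F) :
    DifferentiableAt ℝ (fun z ↦ christoffel b z u v) y := by
  have h1 : DifferentiableAt ℝ (fderiv ℝ b) y :=
    (hb.fderiv_right (m := 1) (by norm_cast)).differentiableAt (by norm_num)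
  have h2 : DifferentiableAt ℝ (fun z ↦ (b z).inverse) y := by
    obtain ⟨e, he⟩ := hinv
    have h3 : DifferentiableAt ℝ (ContinuousLinearMap.inverse : (F →L[ℝ] F →L[ℝ] ℝ) → _) (b y) :=
      he ▸ (contDiffAt_map_inverse (n := 1) e).differentiableAt (by norm_num)
    exact h3.comp y (hb.differentiableAt (by simp))
  refine h2.clm_apply ?_
  have h4 : ∀ w, DifferentiableAt ℝ (fun z ↦ fderiv ℝ b z w) y := fun w ↦
    h1.clm_apply (differentiableAt_const w)
  have h5 : DifferentiableAt ℝ (fun z ↦ ((fderiv ℝ b z).flip u).flip v) y := by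
    have e1 : DifferentiableAt ℝ (fun z ↦ (fderiv ℝ b z).flip) y :=
      (ContinuousLinearMap.flipₗᵢ ℝ F F (F →L[ℝ] ℝ)).toContinuousLinearEquiv.differentiableAt.comp
        y h1
    have e2 : DifferentiableAt ℝ (fun z ↦ ((fderiv ℝ b z).flip u).flip) y :=
      (ContinuousLinearMap.flipₗᵢ ℝ F F ℝ).toContinuousLinearEquiv.differentiableAt.comp
        y (e1.clm_apply (differentiableAt_const u))
    exact e2.clm_apply (differentiableAt_const v)
  exact ((((h4 u).clm_apply (differentiableAt_const v)).add
    ((h4 v).clm_apply (differentiableAt_const u))).sub h5).const_smul (1 / 2 : ℝ)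

/-- The metric product of the derivative of a Christoffel symbol. -/
theorem apply_fderiv_christoffel [CompleteSpace F] {b : F → F →L[ℝ] F →L[ℝ] ℝ} {y : F}
    (hb : ContDiffAt ℝ ∞ b y) (hinv : ∀ᶠ z in 𝓝 y, (b z).IsInvertible) (a u v w : F) :
    fderiv ℝ b y a (christoffel b y u v) w + b y (fderiv ℝ (fun z ↦ christoffel b z u v) y a) w =
      1 / 2 * (fderiv ℝ (fderiv ℝ b) y a u v w + fderiv ℝ (fderiv ℝ b) y a v u w -
        fderiv ℝ (fderiv ℝ b) y a w u v) := by
  have h1 : HasFDerivAt (fderiv ℝ b) (fderiv ℝ (fderiv ℝ b) y) y :=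
    ((hb.fderiv_right (m := 1) (by norm_cast)).differentiableAt (by norm_num)).hasFDerivAt
  have h2 := (hb.differentiableAt (by simp)).hasFDerivAt
  have hΓ := (differentiableAt_christoffel hb hinv.self_of_nhds u v).hasFDerivAt
  have h3 : ∀ p q r : F, HasFDerivAt (fun z ↦ fderiv ℝ b z p q r) _ y := fun p q r ↦
    ((h1.clm_apply (hasFDerivAt_const p y)).clm_apply (hasFDerivAt_const q y)).clm_apply
      (hasFDerivAt_const r y)
  have h4 := (h2.clm_apply hΓ).clm_apply (hasFDerivAt_const w y)
  have h5 := (((h3 u v w).add (h3 v u w)).sub (h3 w u v)).const_mul (1 / 2 : ℝ)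
  have h6 := (h5.congr_of_eventuallyEq (f₁ := fun z ↦ b z (christoffel b z u v) w)
    (hinv.mono fun z hz ↦ apply_christoffel hz u v w)).unique h4
  have h7 := congrArg (fun f : F →L[ℝ] ℝ ↦ f a) h6
  simp at h7
  linarith

/-- The derivative of the Killing equation. -/
theorem IsKillingFieldAt.fderiv_eq {b : F → F →L[ℝ] F →L[ℝ] ℝ} {A : F → F} {y : F}
    (hb : ContDiffAt ℝ ∞ b y) (hA : ContDiffAt ℝ ∞ A y) (hK : IsKillingFieldAt b A y)
    (w u v : F) :
    fderiv ℝ (fderiv ℝ b) y w (A y) u v + fderiv ℝ b y (fderiv ℝ A y w) u v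
      + (fderiv ℝ b y w (fderiv ℝ A y u) v + b y (fderiv ℝ (fderiv ℝ A) y w u) v)
      + (fderiv ℝ b y w u (fderiv ℝ A y v) + b y u (fderiv ℝ (fderiv ℝ A) y w v)) = 0 := by
  have h1 : HasFDerivAt (fderiv ℝ b) (fderiv ℝ (fderiv ℝ b) y) y :=
    ((hb.fderiv_right (m := 1) (by norm_cast)).differentiableAt (by norm_num)).hasFDerivAt
  have h2 := (hb.differentiableAt (by simp)).hasFDerivAt
  have h3 : HasFDerivAt (fderiv ℝ A) (fderiv ℝ (fderiv ℝ A) y) y :=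
    ((hA.fderiv_right (m := 1) (by norm_cast)).differentiableAt (by norm_num)).hasFDerivAt
  have h4 := (hA.differentiableAt (by simp)).hasFDerivAt
  have c := fun p : F ↦ hasFDerivAt_const (𝕜 := ℝ) p y
  have h5 := (((h1.clm_apply h4).clm_apply (c u)).clm_apply (c v)).add
    ((h2.clm_apply (h3.clm_apply (c u))).clm_apply (c v))
  have h6 := h5.add ((h2.clm_apply (c u)).clm_apply (h3.clm_apply (c v)))
  have h7 := (h6.congr_of_eventuallyEq (f₁ := fun _ ↦ (0 : ℝ))
    (hK.mono fun z hz ↦ (hz u v).symm)).unique (hasFDerivAt_const 0 y)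
  have h8 := congrArg (fun f : F →L[ℝ] ℝ ↦ f w) h7
  simp at h8
  linarith

theorem eq_of_apply_eq {B : F →L[ℝ] F →L[ℝ] ℝ} (hB : B.IsInvertible) {x y : F}
    (h : ∀ v, B x v = B y v) : x = y :=
  hB.injective (ContinuousLinearMap.ext h)

/-- Killing fields are affine. -/
theorem IsKillingFieldAt.affine [CompleteSpace F] {b : F → F →L[ℝ] F →L[ℝ] ℝ} {A : F → F} {y : F}
    (hb : ContDiffAt ℝ ∞ b y) (hsymm : ∀ᶠ z in 𝓝 y, ∀ u v, b z u v = b z v u)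
    (hinv : ∀ᶠ z in 𝓝 y, (b z).IsInvertible)
    (hA : ContDiffAt ℝ ∞ A y) (hK : IsKillingFieldAt b A y) (w u : F) :
    fderiv ℝ (fderiv ℝ A) y w u = fderiv ℝ A y (christoffel b y w u)
      - fderiv ℝ (fun z ↦ christoffel b z w u) y (A y)
      - christoffel b y (fderiv ℝ A y w) u - christoffel b y w (fderiv ℝ A y u) := by
  have hi := hinv.self_of_nhds
  have hd := hb.differentiableAt (by simp : (∞ : WithTop ℕ∞) ≠ 0)
  have hd2 : DifferentiableAt ℝ (fderiv ℝ b) y :=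
    (hb.fderiv_right (m := 1) (by norm_cast)).differentiableAt (by norm_num)
  have hbs : IsSymmSndFDerivAt ℝ b y := hb.isSymmSndFDerivAt (by simpa using ENat.LEInfty.out)
  have hAs : IsSymmSndFDerivAt ℝ A y := hA.isSymmSndFDerivAt (by simpa using ENat.LEInfty.out)
  have s0 := hsymm.self_of_nhds
  have s1 := fderiv_apply_symm hd hsymm
  have s2 : ∀ p q u v, fderiv ℝ (fderiv ℝ b) y p q u v = fderiv ℝ (fderiv ℝ b) y p q v u := by
    intro p q u v
    have h : ∀ u v, HasFDerivAt (fun z ↦ fderiv ℝ b z q u v) _ y := fun u v ↦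
      ((hd2.hasFDerivAt.clm_apply (hasFDerivAt_const q y)).clm_apply
        (hasFDerivAt_const u y)).clm_apply (hasFDerivAt_const v y)
    have hev : ∀ᶠ z in 𝓝 y, fderiv ℝ b z q v u = fderiv ℝ b z q u v := by
      have e1 : ∀ᶠ z in 𝓝 y, DifferentiableAt ℝ b z :=
        ((hb.of_le (m := 1) (by norm_cast)).eventually (by simp)).mono fun z hz ↦
          hz.differentiableAt (by norm_num)
      filter_upwards [e1, hsymm.eventually_nhds] with z hz1 hz2
      exact fderiv_apply_symm hz1 hz2 q v u
    have h1 := ((h u v).congr_of_eventuallyEq hev).unique (h v u)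
    simpa using congrArg (fun f : F →L[ℝ] ℝ ↦ f p) h1
  refine eq_of_apply_eq hi fun v ↦ ?_
  simp only [map_sub, sub_apply]
  -- The combination `k1` + `k2` - `k3` of the differentiated Killing equation isolates twice the
  -- product of ∂²A(w, u) with v, as in the derivation of the Christoffel symbols. `k4` and `g1` to
  -- `g4` turn the remaining derivatives of b into Γ and its derivative along A.
  have k1 := hK.fderiv_eq hb hA w u v
  have k2 := hK.fderiv_eq hb hA u w v
  have k3 := hK.fderiv_eq hb hA v u w
  have k4 := hK.self_of_nhds (christoffel b y w u) v
  have g1 := apply_fderiv_christoffel hb hinv (A y) w u v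
  have g2 := apply_christoffel hi (fderiv ℝ A y w) u v
  have g3 := apply_christoffel hi w (fderiv ℝ A y u) v
  have g4 := apply_christoffel hi w u (fderiv ℝ A y v)
  rw [hAs.eq u w, hbs.eq u (A y)] at k2
  rw [hAs.eq v u, hAs.eq v w, hbs.eq v (A y)] at k3
  rw [hbs.eq w (A y)] at k1
  have t1 := s2 (A y) v u w
  have t2 := s1 v (fderiv ℝ A y u) w
  have t3 := s1 v u (fderiv ℝ A y w)
  have t4 := s1 (fderiv ℝ A y v) u w
  have t5 := s0 w (fderiv ℝ (fderiv ℝ A) y u v)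
  linarith

/-- The curvature of a metric in the direction of two Killing fields whose covariant derivatives
vanish at `y` is the derivative of their bracket. -/
theorem curvatureEndo_eq_fderiv_bracket [CompleteSpace F] {b : F → F →L[ℝ] F →L[ℝ] ℝ}
    {A C : F → F} {y : F}
    (hb : ContDiffAt ℝ ∞ b y) (hsymm : ∀ᶠ z in 𝓝 y, ∀ u v, b z u v = b z v u)
    (hinv : ∀ᶠ z in 𝓝 y, (b z).IsInvertible)
    (hA : ContDiffAt ℝ ∞ A y) (hKA : IsKillingFieldAt b A y)
    (hC : ContDiffAt ℝ ∞ C y) (hKC : IsKillingFieldAt b C y)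
    (hA0 : ∀ u, fderiv ℝ A y u = -christoffel b y u (A y))
    (hC0 : ∀ u, fderiv ℝ C y u = -christoffel b y u (C y)) (u : F) :
    curvatureEndo b y (A y) (C y) u =
      fderiv ℝ (fun z ↦ fderiv ℝ C z (A z) - fderiv ℝ A z (C z)) y u := by
  have hd := hb.differentiableAt (by simp : (∞ : WithTop ℕ∞) ≠ 0)
  have h3 : ∀ {D : F → F}, ContDiffAt ℝ ∞ D y →
      HasFDerivAt (fderiv ℝ D) (fderiv ℝ (fderiv ℝ D) y) y := fun hD ↦
    ((hD.fderiv_right (m := 1) (by norm_cast)).differentiableAt (by norm_num)).hasFDerivAt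
  have h4 : ∀ {D : F → F}, ContDiffAt ℝ ∞ D y → HasFDerivAt D (fderiv ℝ D y) y := fun hD ↦
    (hD.differentiableAt (by simp)).hasFDerivAt
  have hs := fun p q : F ↦ christoffel_symm hd hsymm p q
  have hsf : ∀ p q r : F, fderiv ℝ (fun z ↦ christoffel b z p q) y r =
      fderiv ℝ (fun z ↦ christoffel b z q p) y r := by
    intro p q r
    congr 1
    refine Filter.EventuallyEq.fderiv_eq ?_
    have e1 : ∀ᶠ z in 𝓝 y, DifferentiableAt ℝ b z :=
      ((hb.of_le (m := 1) (by norm_cast)).eventually (by simp)).mono fun z hz ↦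
        hz.differentiableAt (by norm_num)
    filter_upwards [e1, hsymm.eventually_nhds] with z hz1 hz2
    exact christoffel_symm hz1 hz2 p q
  have h5 := (((h3 hC).clm_apply (h4 hA)).sub ((h3 hA).clm_apply (h4 hC))).fderiv
  have h6 : fderiv ℝ (fun z ↦ fderiv ℝ C z (A z) - fderiv ℝ A z (C z)) y u =
      (fderiv ℝ C y (fderiv ℝ A y u) + fderiv ℝ (fderiv ℝ C) y u (A y)) -
        (fderiv ℝ A y (fderiv ℝ C y u) + fderiv ℝ (fderiv ℝ A) y u (C y)) := by
    change fderiv ℝ ((fun z ↦ fderiv ℝ C z (A z)) - fun z ↦ fderiv ℝ A z (C z)) y u = _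
    rw [h5]
    simp
  -- The affine equation trades each second derivative for first derivatives of the fields, Γ and a
  -- derivative of Γ. After ∂A = -Γ(·, A) and ∂C = -Γ(·, C), only the terms of the curvature
  -- survive.
  rw [h6, hKC.affine hb hsymm hinv hC u (A y), hKA.affine hb hsymm hinv hA u (C y), curvatureEndo]
  simp only [hA0, hC0, christoffel_neg_left, christoffel_neg_right]
  rw [hs (C y) (A y), hs (A y) (christoffel b y (C y) u), hs (C y) u,
    hs (C y) (christoffel b y (A y) u), hs (A y) u, hsf (C y) u, hsf (A y) u]
  abel

/-- The Koszul formula for Killing fields whose brackets vanish at `y`. -/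
theorem apply_fderiv_of_killing {b : F → F →L[ℝ] F →L[ℝ] ℝ} {A C D : F → F} {y : F}
    (hinv : (b y).IsInvertible) (hd : DifferentiableAt ℝ b y)
    (hsymm : ∀ᶠ z in 𝓝 y, ∀ u v, b z u v = b z v u) (hKA : IsKillingFieldAt b A y)
    (hKC : IsKillingFieldAt b C y) (hKD : IsKillingFieldAt b D y)
    (hAC : fderiv ℝ A y (C y) = fderiv ℝ C y (A y))
    (hAD : fderiv ℝ A y (D y) = fderiv ℝ D y (A y))
    (hCD : fderiv ℝ C y (D y) = fderiv ℝ D y (C y)) :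
    b y (fderiv ℝ A y (C y)) (D y) = b y (-christoffel b y (C y) (A y)) (D y) := by
  have s0 := hsymm.self_of_nhds
  have s1 := fderiv_apply_symm hd hsymm
  rw [map_neg, neg_apply, apply_christoffel hinv]
  have k1 := hKA.self_of_nhds (C y) (D y)
  have k2 := hKC.self_of_nhds (A y) (D y)
  have k3 := hKD.self_of_nhds (C y) (A y)
  rw [← hAC, hCD] at k2
  -- With vanishing brackets, the three Killing equations at y are three linear relations among the
  -- products b(∂_C A, D), b(∂_D A, C), b(∂_D C, A), and hence determine them.
  rw [hAD] at k1
  have t1 := s0 (A y) (fderiv ℝ D y (C y))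
  have t2 := s0 (C y) (fderiv ℝ D y (A y))
  have t3 := s1 (D y) (C y) (A y)
  linarith

/-- The curvature of a metric with a transitive Lie algebra of Killing fields, in directions in a
subset `p` of this Lie algebra with `[p, p]` vanishing at `y`. -/
theorem curvatureEndo_of_killing_family [CompleteSpace F] {L : Type*} [Bracket L L]
    {b : F → F →L[ℝ] F →L[ℝ] ℝ} {y : F} (hb : ContDiffAt ℝ ∞ b y)
    (hsymm : ∀ᶠ z in 𝓝 y, ∀ u v, b z u v = b z v u)
    (hinv : ∀ᶠ z in 𝓝 y, (b z).IsInvertible) (S : L → F → F)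
    (hS : ∀ X, ContDiffAt ℝ ∞ (S X) y) (hK : ∀ X, IsKillingFieldAt b (S X) y)
    (hbr : ∀ X Y, ∀ᶠ z in 𝓝 y,
      fderiv ℝ (S Y) z (S X z) - fderiv ℝ (S X) z (S Y z) = -S ⁅X, Y⁆ z)
    (p : Set L) (h0 : ∀ X ∈ p, ∀ Y ∈ p, S ⁅X, Y⁆ y = 0) (hsurj : ∀ v, ∃ X ∈ p, S X y = v)
    {X Y W : L} (hX : X ∈ p) (hY : Y ∈ p) :
    curvatureEndo b y (S X y) (S Y y) (S W y) = S ⁅W, ⁅X, Y⁆⁆ y := by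
  have hi := hinv.self_of_nhds
  have hd := hb.differentiableAt (by simp : (∞ : WithTop ℕ∞) ≠ 0)
  have hcomm : ∀ X ∈ p, ∀ Y ∈ p, fderiv ℝ (S X) y (S Y y) = fderiv ℝ (S Y) y (S X y) := by
    intro X hX Y hY
    have h := (hbr X Y).self_of_nhds
    rw [h0 X hX Y hY, neg_zero, sub_eq_zero] at h
    exact h.symm
  -- Fields from `p` have vanishing covariant derivative at y: they span all directions and commute
  -- pairwise at y, so the Koszul formula applies to every triple.
  have hcov : ∀ X ∈ p, ∀ u, fderiv ℝ (S X) y u = -christoffel b y u (S X y) := by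
    intro X hX u
    obtain ⟨Y, hY, rfl⟩ := hsurj u
    refine eq_of_apply_eq hi fun v ↦ ?_
    obtain ⟨Z, hZ, rfl⟩ := hsurj v
    exact apply_fderiv_of_killing hi hd hsymm (hK X) (hK Y) (hK Z) (hcomm X hX Y hY)
      (hcomm X hX Z hZ) (hcomm Y hY Z hZ)
  rw [curvatureEndo_eq_fderiv_bracket hb hsymm hinv (hS X) (hK X) (hS Y) (hK Y) (hcov X hX)
    (hcov Y hY), Filter.EventuallyEq.fderiv_eq (hbr X Y)]
  have h1 := (hbr W ⁅X, Y⁆).self_of_nhds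
  rw [h0 X hX Y hY, map_zero, sub_zero] at h1
  rw [fderiv_fun_neg, neg_apply, h1, neg_neg]

end KillingFields

/-! ### Local actions of local groups -/

section LocalActions

variable {E F : Type*} [NormedAddCommGroup E] [NormedSpace ℝ E] [NormedAddCommGroup F]
  [NormedSpace ℝ F]

/-- The action field of `X` for the local action `Φ`, where `e` is the neutral element. -/
noncomputable def actionField (Φ : E × F → F) (e : E) (X : E) (y : F) : F := fderiv ℝ Φ (e, y) (X, 0)

/-- The mixed second derivative at `(e, e)` of a multiplication `μ`. -/
noncomputable def mixedDeriv (μ : E × E → E) (e : E) (X Y : E) : E :=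
  fderiv ℝ (fderiv ℝ μ) (e, e) (X, 0) (0, Y)

theorem ContDiffAt.fderiv_infty {f : E → F} {x : E} (hf : ContDiffAt ℝ ∞ f x) :
    ContDiffAt ℝ ∞ (fderiv ℝ f) x :=
  hf.fderiv_right (by simp)

theorem ContDiffAt.hasFDerivAt_fderiv {f : E → F} {x : E} (hf : ContDiffAt ℝ 2 f x) :
    HasFDerivAt (fderiv ℝ f) (fderiv ℝ (fderiv ℝ f) x) x :=
  ((hf.fderiv_right (m := 1) (by norm_num)).differentiableAt (by norm_num)).hasFDerivAt

theorem contDiffAt_actionField {Φ : E × F → F} {e : E} {y : F} (hΦ : ContDiffAt ℝ ∞ Φ (e, y))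
    (X : E) : ContDiffAt ℝ ∞ (actionField Φ e X) y :=
  (hΦ.fderiv_infty.comp y (contDiffAt_const.prodMk contDiffAt_id)).clm_apply contDiffAt_const

theorem actionField_sub (Φ : E × F → F) (e : E) (X Y : E) (y : F) :
    actionField Φ e (X - Y) y = actionField Φ e X y - actionField Φ e Y y := by
  rw [actionField, actionField, actionField, ← map_sub]
  simp

theorem fderiv_actionField {Φ : E × F → F} {e : E} {y : F} (hΦ : ContDiffAt ℝ 2 Φ (e, y))
    (X : E) (v : F) :
    fderiv ℝ (actionField Φ e X) y v = fderiv ℝ (fderiv ℝ Φ) (e, y) (X, 0) (0, v) := by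
  have h1 := (hΦ.hasFDerivAt_fderiv.comp y (hasFDerivAt_prodMk_right e y)).clm_apply
    (hasFDerivAt_const ((X, 0) : E × F) y)
  have h2 : fderiv ℝ (actionField Φ e X) y = _ := h1.fderiv
  have hs : IsSymmSndFDerivAt ℝ Φ (e, y) := hΦ.isSymmSndFDerivAt (by simp)
  rw [h2, hs.eq]
  simp

theorem fderiv_apply_inr {f : E × F → F} {e : E} {y : F} (hf : DifferentiableAt ℝ f (e, y))
    (h : ∀ᶠ z in 𝓝 y, f (e, z) = z) (v : F) : fderiv ℝ f (e, y) (0, v) = v := by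
  have h1 := hf.hasFDerivAt.comp y (hasFDerivAt_prodMk_right e y)
  have h2 := (h1.congr_of_eventuallyEq (f₁ := id) (h.mono fun z hz ↦ hz.symm)).unique
    (hasFDerivAt_id y)
  simpa using congrArg (fun f : F →L[ℝ] F ↦ f v) h2

/-- Differentiate Φ(μ(x, x'), y) = Φ(x, Φ(x', y)) in x' along Y and then in x along X, both at e. -/
theorem fderiv_actionField_actionField {Φ : E × F → F} {μ : E × E → E} {e : E} {y : F}
    (hΦ : ContDiffAt ℝ 3 Φ (e, y)) (hμ : ContDiffAt ℝ 3 μ (e, e)) (hΦe : Φ (e, y) = y)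
    (hμl : ∀ᶠ x in 𝓝 e, μ (e, x) = x) (hμr : ∀ᶠ x in 𝓝 e, μ (x, e) = x)
    (hassoc : ∀ᶠ p : E × E in 𝓝 (e, e), Φ (μ p, y) = Φ (p.1, Φ (p.2, y))) (X Y : E) :
    fderiv ℝ (actionField Φ e X) y (actionField Φ e Y y) =
      fderiv ℝ (fderiv ℝ Φ) (e, y) (X, 0) (Y, 0) + actionField Φ e (mixedDeriv μ e X Y) y := by
  rw [fderiv_actionField (hΦ.of_le (by norm_num))]
  have hΦ' : ∀ᶠ x in 𝓝 e, ContDiffAt ℝ 3 Φ (x, y) :=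
    ((continuous_id.prodMk continuous_const).tendsto e).eventually (hΦ.eventually (by simp))
  have hμ' : ∀ᶠ x in 𝓝 e, ContDiffAt ℝ 3 μ (x, e) :=
    ((continuous_id.prodMk continuous_const).tendsto e).eventually (hμ.eventually (by simp))
  rw [nhds_prod_eq] at hassoc
  -- The derivative in x' at e, kept for all x near e so that it can be differentiated again.
  have h1 : ∀ᶠ x in 𝓝 e, fderiv ℝ Φ (x, y) (fderiv ℝ μ (x, e) (0, Y), 0) =
      fderiv ℝ Φ (x, y) (0, actionField Φ e Y y) := by
    filter_upwards [hassoc.curry, hΦ', hμ', hμr] with x hx hΦx hμx hxe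
    have d1 : HasFDerivAt (fun x' ↦ μ (x, x')) _ e :=
      (hμx.differentiableAt (by norm_num)).hasFDerivAt.comp e (hasFDerivAt_prodMk_right x e)
    have d2 : HasFDerivAt Φ (fderiv ℝ Φ (x, y)) (μ (x, e), y) := by
      rw [hxe]
      exact (hΦx.differentiableAt (by norm_num)).hasFDerivAt
    have d3 := d2.comp e (d1.prodMk (hasFDerivAt_const y e))
    have d4 : HasFDerivAt (fun x' ↦ Φ (x', y)) _ e :=
      (hΦ.differentiableAt (by norm_num)).hasFDerivAt.comp e (hasFDerivAt_prodMk_left e y)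
    have d5 : HasFDerivAt Φ (fderiv ℝ Φ (x, y)) (x, Φ (e, y)) := by
      rw [hΦe]
      exact (hΦx.differentiableAt (by norm_num)).hasFDerivAt
    have d6 := d5.comp e ((hasFDerivAt_const x e).prodMk d4)
    have d7 := (d3.congr_of_eventuallyEq (hx.mono fun x' hx' ↦ hx'.symm)).unique d6
    simpa [actionField] using congrArg (fun f : E →L[ℝ] F ↦ f Y) d7
  have c1 := (hΦ.of_le (by norm_num : (2 : WithTop ℕ∞) ≤ 3)).hasFDerivAt_fderiv.comp
    (f := fun x ↦ (x, y)) e (hasFDerivAt_prodMk_left e y)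
  have c2 := (hμ.of_le (by norm_num : (2 : WithTop ℕ∞) ≤ 3)).hasFDerivAt_fderiv.comp
    (f := fun x ↦ (x, e)) e (hasFDerivAt_prodMk_left e e)
  have c3 := c2.clm_apply (hasFDerivAt_const ((0, Y) : E × E) e)
  have c4 := c1.clm_apply (c3.prodMk (hasFDerivAt_const (0 : F) e))
  have c5 := c1.clm_apply (hasFDerivAt_const ((0, actionField Φ e Y y) : E × F) e)
  have c6 := (c4.congr_of_eventuallyEq (h1.mono fun x hx ↦ hx.symm)).unique c5
  have c7 := congrArg (fun f : E →L[ℝ] F ↦ f X) c6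
  have c8 := fderiv_apply_inr (hμ.differentiableAt (by norm_num)) hμl Y
  simp [c8] at c7
  rw [← c7, add_comm]
  rfl

/-- In the difference the second derivative of Φ along (X, 0) and (Y, 0) cancels by symmetry. The
minus sign reflects that a left action induces an antihomomorphism to vector fields. -/
theorem actionField_bracket {Φ : E × F → F} {μ : E × E → E} {e : E} {y : F}
    (hΦ : ContDiffAt ℝ ∞ Φ (e, y)) (hμ : ContDiffAt ℝ ∞ μ (e, e))
    (hΦe : ∀ᶠ z in 𝓝 y, Φ (e, z) = z)
    (hμl : ∀ᶠ x in 𝓝 e, μ (e, x) = x) (hμr : ∀ᶠ x in 𝓝 e, μ (x, e) = x)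
    (hassoc : ∀ᶠ p : (E × E) × F in 𝓝 ((e, e), y), Φ (μ p.1, p.2) = Φ (p.1.1, Φ (p.1.2, p.2)))
    (X Y : E) : ∀ᶠ z in 𝓝 y,
      fderiv ℝ (actionField Φ e Y) z (actionField Φ e X z)
        - fderiv ℝ (actionField Φ e X) z (actionField Φ e Y z) =
      -actionField Φ e (mixedDeriv μ e X Y - mixedDeriv μ e Y X) z := by
  have h3 : (3 : WithTop ℕ∞) ≤ ∞ := ENat.LEInfty.out
  have h1 : ∀ᶠ z in 𝓝 y, ContDiffAt ℝ 3 Φ (e, z) :=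
    ((continuous_const.prodMk continuous_id).tendsto y).eventually
      ((hΦ.of_le h3).eventually (by simp))
  have h2 : ∀ᶠ z in 𝓝 y, ∀ᶠ p : (E × E) × F in 𝓝 ((e, e), z),
      Φ (μ p.1, p.2) = Φ (p.1.1, Φ (p.1.2, p.2)) :=
    ((continuous_const.prodMk continuous_id).tendsto y).eventually hassoc.eventually_nhds
  filter_upwards [h1, h2, hΦe] with z hz1 hz2 hz3
  have hz4 : ∀ᶠ p : E × E in 𝓝 (e, e), Φ (μ p, z) = Φ (p.1, Φ (p.2, z)) :=
    ((continuous_id.prodMk continuous_const).tendsto (e, e)).eventually hz2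
  rw [fderiv_actionField_actionField hz1 (hμ.of_le h3) hz3 hμl hμr hz4,
    fderiv_actionField_actionField hz1 (hμ.of_le h3) hz3 hμl hμr hz4, actionField_sub]
  have hs : IsSymmSndFDerivAt ℝ Φ (e, z) := hz1.isSymmSndFDerivAt (by simp; norm_num)
  rw [hs.eq (Y, 0) (X, 0)]
  abel

/-- The Killing equation is the derivative at x = e of the statement that Φ(x, ·) is an isometry. -/
theorem isKillingFieldAt_actionField {Φ : E × F → F} {e : E} {y : F}
    {b : F → F →L[ℝ] F →L[ℝ] ℝ} (hb : ContDiffAt ℝ ∞ b y) (hΦ : ContDiffAt ℝ ∞ Φ (e, y))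
    (hΦe : ∀ᶠ z in 𝓝 y, Φ (e, z) = z)
    (hinv : ∀ᶠ p : E × F in 𝓝 (e, y), ∀ u v,
      b (Φ p) (fderiv ℝ Φ p (0, u)) (fderiv ℝ Φ p (0, v)) = b p.2 u v) (X : E) :
    IsKillingFieldAt b (actionField Φ e X) y := by
  have h2 : (2 : WithTop ℕ∞) ≤ ∞ := ENat.LEInfty.out
  have h1 : ∀ᶠ z in 𝓝 y, ContDiffAt ℝ 2 Φ (e, z) :=
    ((continuous_const.prodMk continuous_id).tendsto y).eventually
      ((hΦ.of_le h2).eventually (by simp))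
  have h3 : ∀ᶠ z in 𝓝 y, ∀ᶠ p : E × F in 𝓝 (e, z), ∀ u v,
      b (Φ p) (fderiv ℝ Φ p (0, u)) (fderiv ℝ Φ p (0, v)) = b p.2 u v :=
    ((continuous_const.prodMk continuous_id).tendsto y).eventually hinv.eventually_nhds
  filter_upwards [h1, h3, hΦe.eventually_nhds, (hb.of_le h2).eventually (by simp)]
    with z hz1 hz2 hz3 hz4 u v
  have hz5 : ∀ᶠ x in 𝓝 e, b (Φ (x, z)) (fderiv ℝ Φ (x, z) (0, u)) (fderiv ℝ Φ (x, z) (0, v)) =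
      b z u v :=
    (((continuous_id.prodMk continuous_const).tendsto e).eventually hz2).mono fun x hx ↦ hx u v
  have c0 := hasFDerivAt_prodMk_left (𝕜 := ℝ) e z
  have c1 := hz1.hasFDerivAt_fderiv.comp (f := fun x ↦ (x, z)) e c0
  have c2 : ∀ w, HasFDerivAt (fun x ↦ fderiv ℝ Φ (x, z) (0, w)) _ e := fun w ↦
    c1.clm_apply (hasFDerivAt_const ((0, w) : E × F) e)
  have c3 : HasFDerivAt (fun x ↦ Φ (x, z)) _ e :=
    (hz1.differentiableAt (by norm_num)).hasFDerivAt.comp e c0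
  have c4 : HasFDerivAt b (fderiv ℝ b z) (Φ (e, z)) := by
    rw [hz3.self_of_nhds]
    exact (hz4.differentiableAt (by norm_num)).hasFDerivAt
  have c5 := ((c4.comp e c3).clm_apply (c2 u)).clm_apply (c2 v)
  have c6 := (c5.congr_of_eventuallyEq (hz5.mono fun x hx ↦ hx.symm)).unique
    (hasFDerivAt_const (b z u v) e)
  have c7 := congrArg (fun f : E →L[ℝ] ℝ ↦ f X) c6
  have c8 := fderiv_apply_inr (hz1.differentiableAt (by norm_num)) hz3
  rw [fderiv_actionField hz1, fderiv_actionField hz1]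
  simp [c8, hz3.self_of_nhds] at c7
  rw [actionField]
  linarith

/-- Two derivatives of s(μ(x, x')) = μ(s x, s x') give the identity for the mixed derivative with an
extra term ∂²s(X, Y), which is symmetric and drops out of the bracket. -/
theorem fderiv_mixedDeriv_bracket {μ : E × E → E} {s : E → E} {e : E}
    (hμ : ContDiffAt ℝ ∞ μ (e, e)) (hs : ContDiffAt ℝ ∞ s e) (hse : s e = e)
    (hμl : ∀ᶠ x in 𝓝 e, μ (e, x) = x) (hμr : ∀ᶠ x in 𝓝 e, μ (x, e) = x)
    (hhom : ∀ᶠ p : E × E in 𝓝 (e, e), s (μ p) = μ (s p.1, s p.2)) (X Y : E) :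
    fderiv ℝ s e (mixedDeriv μ e X Y - mixedDeriv μ e Y X) =
      mixedDeriv μ e (fderiv ℝ s e X) (fderiv ℝ s e Y)
        - mixedDeriv μ e (fderiv ℝ s e Y) (fderiv ℝ s e X) := by
  have h2 : (2 : WithTop ℕ∞) ≤ ∞ := ENat.LEInfty.out
  have hse' : Filter.Tendsto s (𝓝 e) (𝓝 e) := by
    have := hs.continuousAt
    rwa [ContinuousAt, hse] at this
  have hsy : IsSymmSndFDerivAt ℝ s e := hs.isSymmSndFDerivAt (by simpa using h2)
  have hμ' : ∀ᶠ x in 𝓝 e, ContDiffAt ℝ 2 μ (x, e) :=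
    ((continuous_id.prodMk continuous_const).tendsto e).eventually
      ((hμ.of_le h2).eventually (by simp))
  have hs' := (hs.of_le h2).eventually (by simp)
  have d0 := (hs.differentiableAt (by simp)).hasFDerivAt
  rw [nhds_prod_eq] at hhom
  have key : ∀ X Y, fderiv ℝ (fderiv ℝ s) e X Y + fderiv ℝ s e (mixedDeriv μ e X Y) =
      mixedDeriv μ e (fderiv ℝ s e X) (fderiv ℝ s e Y) := by
    intro X Y
    have h1 : ∀ᶠ x in 𝓝 e, fderiv ℝ s x (fderiv ℝ μ (x, e) (0, Y)) =
        fderiv ℝ μ (s x, e) (0, fderiv ℝ s e Y) := by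
      filter_upwards [hhom.curry, hμ', hse'.eventually hμ', hs', hμr] with x hx hx1 hx2 hx3 hxe
      have d1 : HasFDerivAt (fun x' ↦ μ (x, x')) _ e :=
        (hx1.differentiableAt (by norm_num)).hasFDerivAt.comp e (hasFDerivAt_prodMk_right x e)
      have d2 : HasFDerivAt s (fderiv ℝ s x) (μ (x, e)) := by
        rw [hxe]
        exact (hx3.differentiableAt (by norm_num)).hasFDerivAt
      have d3 := d2.comp e d1
      have d4 : HasFDerivAt μ (fderiv ℝ μ (s x, e)) (s x, s e) := by
        rw [hse]
        exact (hx2.differentiableAt (by norm_num)).hasFDerivAt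
      have d5 := d4.comp e ((hasFDerivAt_const (s x) e).prodMk d0)
      have d6 := (d3.congr_of_eventuallyEq (hx.mono fun x' hx' ↦ hx'.symm)).unique d5
      simpa using congrArg (fun f : E →L[ℝ] E ↦ f Y) d6
    have c1 := (hμ.of_le h2).hasFDerivAt_fderiv
    have c2 := (c1.comp (f := fun x ↦ (x, e)) e (hasFDerivAt_prodMk_left e e)).clm_apply
      (hasFDerivAt_const ((0, Y) : E × E) e)
    have c3 := (hs.of_le h2).hasFDerivAt_fderiv.clm_apply c2
    have c4 : HasFDerivAt (fderiv ℝ μ) (fderiv ℝ (fderiv ℝ μ) (e, e)) (s e, e) := by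
      rw [hse]
      exact c1
    have c5 := (c4.comp (f := fun x ↦ (s x, e)) e (d0.prodMk (hasFDerivAt_const e e))).clm_apply
      (hasFDerivAt_const ((0, fderiv ℝ s e Y) : E × E) e)
    have c6 := (c3.congr_of_eventuallyEq (h1.mono fun x hx ↦ hx.symm)).unique c5
    have c7 := congrArg (fun f : E →L[ℝ] E ↦ f X) c6
    have c8 := fderiv_apply_inr (hμ.differentiableAt (by simp)) hμl Y
    simp [c8] at c7
    rw [add_comm]
    exact c7
  rw [map_sub, ← key X Y, ← key Y X, hsy.eq Y X]
  abel

end LocalActions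

/-! ### The metric in a chart -/

section MetricInChart

variable {E : Type*} [NormedAddCommGroup E] [NormedSpace ℝ E]
  {M : Type*} [TopologicalSpace M] [ChartedSpace E M]

theorem extChartAt_target_mem_nhds_of_mem {x : M} {y : E}
    (hy : y ∈ (extChartAt 𝓘(ℝ, E) x).target) : (extChartAt 𝓘(ℝ, E) x).target ∈ 𝓝 y :=
  (isOpen_extChartAt_target x).mem_nhds hy

variable [IsManifold 𝓘(ℝ, E) ∞ M]

theorem contMDiffAt_extChartAt_symm_of_mem {x : M} {y : E}
    (hy : y ∈ (extChartAt 𝓘(ℝ, E) x).target) :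
    ContMDiffAt 𝓘(ℝ, E) 𝓘(ℝ, E) ∞ (extChartAt 𝓘(ℝ, E) x).symm y :=
  (contMDiffOn_extChartAt_symm x).contMDiffAt (extChartAt_target_mem_nhds_of_mem hy)

theorem contMDiffAt_extChartAt_of_mem {x p : M} (hp : p ∈ (extChartAt 𝓘(ℝ, E) x).source) :
    ContMDiffAt 𝓘(ℝ, E) 𝓘(ℝ, E) ∞ (extChartAt 𝓘(ℝ, E) x) p :=
  contMDiffAt_extChartAt' (by rwa [extChartAt_source] at hp)

theorem inChart_apply (g : SmoothMetric E M) (x : M) (y u v : E) :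
    g.inChart x y u v = g.inner ((extChartAt 𝓘(ℝ, E) x).symm y)
      (mfderiv 𝓘(ℝ, E) 𝓘(ℝ, E) (extChartAt 𝓘(ℝ, E) x).symm y u)
      (mfderiv 𝓘(ℝ, E) 𝓘(ℝ, E) (extChartAt 𝓘(ℝ, E) x).symm y v) := rfl

theorem inChart_symm (g : SmoothMetric E M) (x : M) (y u v : E) :
    g.inChart x y u v = g.inChart x y v u := by
  rw [inChart_apply, inChart_apply, g.symm]

theorem mfderiv_extChartAt_symm_injective {x : M} {y : E}
    (hy : y ∈ (extChartAt 𝓘(ℝ, E) x).target) :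
    Function.Injective (mfderiv 𝓘(ℝ, E) 𝓘(ℝ, E) (extChartAt 𝓘(ℝ, E) x).symm y) := by
  have h := isInvertible_mfderivWithin_extChartAt_symm (I := 𝓘(ℝ, E)) hy
  simp only [modelWithCornersSelf_coe, Set.range_id, mfderivWithin_univ] at h
  exact h.injective

/-- Positivity gives injectivity, and dimensions agree. Without invertibility the inverse in the
Christoffel symbols would take its default value 0. -/
theorem isInvertible_inChart [FiniteDimensional ℝ E] (g : SmoothMetric E M) {x : M} {y : E}
    (hy : y ∈ (extChartAt 𝓘(ℝ, E) x).target) : (g.inChart x y).IsInvertible := by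
  have hinj : Function.Injective (g.inChart x y) := by
    rw [injective_iff_map_eq_zero]
    intro u hu
    by_contra hu0
    have h1 : mfderiv 𝓘(ℝ, E) 𝓘(ℝ, E) (extChartAt 𝓘(ℝ, E) x).symm y u ≠ 0 := fun h ↦
      hu0 (mfderiv_extChartAt_symm_injective hy (h.trans (map_zero _).symm))
    have h2 := g.pos _ _ h1
    rw [← inChart_apply, hu] at h2
    exact lt_irrefl _ h2
  have hdim : Module.finrank ℝ E = Module.finrank ℝ (E →L[ℝ] ℝ) := by
    rw [← (LinearMap.toContinuousLinearMap (𝕜 := ℝ) (E := E) (F' := ℝ)).finrank_eq,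
      Subspace.dual_finrank_eq]
  exact ⟨(LinearEquiv.ofInjectiveOfFinrankEq (g.inChart x y : E →ₗ[ℝ] E →L[ℝ] ℝ)
    hinj hdim).toContinuousLinearEquiv, by ext; rfl⟩

/-- In the trivialisation of the tangent bundle at x, this coordinate field is the constant section
u. -/
theorem contMDiffAt_mfderiv_extChartAt_symm {x : M} {y : E}
    (hy : y ∈ (extChartAt 𝓘(ℝ, E) x).target) (u : E) :
    ContMDiffAt 𝓘(ℝ, E) (𝓘(ℝ, E).prod 𝓘(ℝ, E)) ∞
      (fun z : E ↦ TotalSpace.mk' E (E := fun p : M ↦ TangentSpace 𝓘(ℝ, E) p)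
        ((extChartAt 𝓘(ℝ, E) x).symm z)
        (mfderiv 𝓘(ℝ, E) 𝓘(ℝ, E) (extChartAt 𝓘(ℝ, E) x).symm z u)) y := by
  let e := trivializationAt E (fun p : M ↦ TangentSpace 𝓘(ℝ, E) p) x
  have h1 : ContMDiffOn 𝓘(ℝ, E) (𝓘(ℝ, E).prod 𝓘(ℝ, E)) ∞
      (fun p : M ↦ TotalSpace.mk' E (E := fun p : M ↦ TangentSpace 𝓘(ℝ, E) p) p (e.symm p u))
      e.baseSet := by
    rw [e.contMDiffOn_section_baseSet_iff]
    refine (contMDiffOn_const (c := u)).congr fun p hp ↦ ?_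
    rw [e.apply_mk_symm hp]
  have hp := (extChartAt 𝓘(ℝ, E) x).map_target hy
  rw [extChartAt_source] at hp
  have h2 := (h1.contMDiffAt (x := (extChartAt 𝓘(ℝ, E) x).symm y)
    (e.open_baseSet.mem_nhds hp)).comp y (contMDiffAt_extChartAt_symm_of_mem hy)
  refine h2.congr_of_eventuallyEq ?_
  filter_upwards [extChartAt_target_mem_nhds_of_mem hy] with z hz
  have hz' := (extChartAt 𝓘(ℝ, E) x).map_target hz
  rw [extChartAt_source] at hz'
  have h3 := TangentBundle.symmL_trivializationAt (I := 𝓘(ℝ, E)) hz'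
  rw [(extChartAt 𝓘(ℝ, E) x).right_inv hz] at h3
  simp only [modelWithCornersSelf_coe, Set.range_id, mfderivWithin_univ] at h3
  have h4 := e.symmL_apply (R := ℝ) hz' u
  exact congrArg (TotalSpace.mk' E _) ((congrArg (fun f ↦ f u) h3.symm).trans h4)

theorem contDiffAt_inChart [FiniteDimensional ℝ E] (g : SmoothMetric E M) {x : M} {y : E}
    (hy : y ∈ (extChartAt 𝓘(ℝ, E) x).target) : ContDiffAt ℝ ∞ (g.inChart x) y := by
  have h : ContDiffOn ℝ ∞ (g.inChart x) (extChartAt 𝓘(ℝ, E) x).target := by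
    rw [contDiffOn_clm_apply]
    intro u
    rw [contDiffOn_clm_apply]
    intro v z hz
    refine ContDiffAt.contDiffWithinAt (contMDiffAt_iff_contDiffAt.mp ?_)
    have h1 := (g.contMDiff.contMDiffAt (x := (extChartAt 𝓘(ℝ, E) x).symm z)).comp z
      (contMDiffAt_extChartAt_symm_of_mem hz)
    have h2 := ContMDiffAt.clm_bundle_apply₂ (F₃ := ℝ) (E₃ := Bundle.Trivial M ℝ) h1
      (contMDiffAt_mfderiv_extChartAt_symm hz u) (contMDiffAt_mfderiv_extChartAt_symm hz v)
    rw [contMDiffAt_totalSpace] at h2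
    exact h2.2
  exact h.contDiffAt (extChartAt_target_mem_nhds_of_mem hy)

end MetricInChart

/-! ### Local sections of submersions -/

section Submersion

variable {E F : Type*} [NormedAddCommGroup E] [NormedSpace ℝ E] [NormedAddCommGroup F]
  [NormedSpace ℝ F] {M N : Type*} [TopologicalSpace M] [ChartedSpace E M]
  [TopologicalSpace N] [ChartedSpace F N]

/-- In adapted charts f is a linear projection; the section freezes the complementary coordinate at
its value for x. -/
theorem Manifold.IsSubmersionAt.exists_section {f : M → N} {x : M}
    (hf : IsSubmersionAt 𝓘(ℝ, E) 𝓘(ℝ, F) ∞ f x) :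
    ∃ s : N → M, ContMDiffAt 𝓘(ℝ, F) 𝓘(ℝ, E) ∞ s (f x) ∧ s (f x) = x ∧
      ∀ᶠ m in 𝓝 (f x), f (s m) = m := by
  let c := hf.domChart.extend 𝓘(ℝ, E)
  let d := hf.codChart.extend 𝓘(ℝ, F)
  let q : F → E := fun v ↦ hf.equiv.symm (v, (hf.equiv (c x)).2)
  have hxc : x ∈ hf.domChart.source := hf.mem_domChart_source
  have hxd : f x ∈ hf.codChart.source := hf.mem_codChart_source
  have hw : Set.EqOn (d ∘ f ∘ c.symm) (Prod.fst ∘ hf.equiv) c.target := hf.writtenInCharts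
  have hxc' : x ∈ c.source := by simpa [c] using hxc
  have hq : q (d (f x)) = c x := by
    have h1 : d (f (c.symm (c x))) = (hf.equiv (c x)).1 := hw (c.map_source hxc')
    rw [c.left_inv hxc'] at h1
    simp only [q, h1, Prod.mk.eta, ContinuousLinearEquiv.symm_apply_apply]
  have hd : ContMDiffAt 𝓘(ℝ, F) 𝓘(ℝ, F) ∞ d (f x) :=
    (contMDiffOn_of_mem_maximalAtlas hf.codChart_mem_maximalAtlas).contMDiffAt
      (hf.codChart.open_source.mem_nhds hxd)
  have hqd : ContMDiffAt 𝓘(ℝ, F) 𝓘(ℝ, E) ∞ (q ∘ d) (f x) := by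
    refine ContMDiffAt.comp (f x) (ContDiff.contMDiff ?_).contMDiffAt hd
    exact hf.equiv.symm.contDiff.comp (contDiff_id.prodMk contDiff_const)
  have ht : c.target ∈ 𝓝 (c x) := by
    have h1 := hf.domChart.extend_target_mem_nhdsWithin (I := 𝓘(ℝ, E)) hxc
    rwa [modelWithCornersSelf_coe, Set.range_id, nhdsWithin_univ] at h1
  have hcs : ContMDiffAt 𝓘(ℝ, E) 𝓘(ℝ, E) ∞ c.symm (c x) :=
    (contMDiffOn_extend_symm hf.domChart_mem_maximalAtlas).contMDiffAt (by rwa [← hf.domChart.extend_target'])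
  have ht' : ∀ᶠ m in 𝓝 (f x), q (d m) ∈ c.target :=
    hqd.continuousAt.eventually (by rw [Function.comp_apply, hq]; exact ht)
  refine ⟨c.symm ∘ q ∘ d, ContMDiffAt.comp (f x) (by rwa [Function.comp_apply, hq]) hqd, ?_, ?_⟩
  · rw [Function.comp_apply, Function.comp_apply, hq, c.left_inv hxc']
  · filter_upwards [ht', hf.codChart.open_source.mem_nhds hxd] with m hm hm'
    have h1 : d (f (c.symm (q (d m)))) = (hf.equiv (q (d m))).1 := hw hm
    rw [ContinuousLinearEquiv.apply_symm_apply] at h1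
    have h2 : f (c.symm (q (d m))) ∈ hf.codChart.source := by
      apply hf.source_subset_preimage_source
      simpa [c] using c.map_target hm
    exact d.injOn (by simpa [d] using h2) (by simpa [d] using hm') h1

end Submersion

/-! ### Smoothness of the action on a quotient. -/

section Quotient

variable {E F : Type*} [NormedAddCommGroup E] [NormedSpace ℝ E] [NormedAddCommGroup F]
  [NormedSpace ℝ F] {G : Type*} [TopologicalSpace G] [ChartedSpace E G] [Group G]
  {K : Subgroup G} [ChartedSpace F (G ⧸ K)]

/-- Near (a, bK) the action is (a', m) ↦ π(a' s(m)) for a local section s of π at b. -/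
theorem contMDiff_quotient_smul [LieGroup 𝓘(ℝ, E) ∞ G]
    (hπ : IsSubmersion 𝓘(ℝ, E) 𝓘(ℝ, F) ∞ (fun a : G ↦ (a : G ⧸ K))) :
    ContMDiff (𝓘(ℝ, E).prod 𝓘(ℝ, F)) 𝓘(ℝ, F) ∞ (fun p : G × (G ⧸ K) ↦ p.1 • p.2) := by
  rintro ⟨a, x⟩
  obtain ⟨b, rfl⟩ := QuotientGroup.mk_surjective x
  obtain ⟨s, hs, hsb, hsec⟩ := (hπ.isSubmersionAt b).exists_section
  have h1 : ContMDiffAt (𝓘(ℝ, E).prod 𝓘(ℝ, F)) 𝓘(ℝ, E) ∞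
      (fun p : G × (G ⧸ K) ↦ p.1 * s p.2) (a, (b : G ⧸ K)) :=
    contMDiffAt_fst.mul (hs.comp (a, (b : G ⧸ K)) contMDiffAt_snd)
  have h2 := (hπ.isSubmersionAt (a * s b)).contMDiffAt.comp (a, (b : G ⧸ K)) h1
  refine h2.congr_of_eventuallyEq ?_
  filter_upwards [continuousAt_snd.eventually hsec] with p hp
  rw [Function.comp_apply, ← smul_eq_mul, ← MulAction.Quotient.smul_mk]
  exact congrArg (p.1 • ·) hp.symm

theorem projDeriv_surjective
    (hπ : IsSubmersion 𝓘(ℝ, E) 𝓘(ℝ, F) ∞ (fun a : G ↦ (a : G ⧸ K))) :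
    Function.Surjective (projDeriv E F K) := by
  intro v
  obtain ⟨s, hs, hs1, hsec⟩ := (hπ.isSubmersionAt 1).exists_section
  have h1 : MDifferentiableAt 𝓘(ℝ, E) 𝓘(ℝ, F) (fun a : G ↦ (a : G ⧸ K)) (s (1 : G)) :=
    (hπ.isSubmersionAt _).contMDiffAt.mdifferentiableAt (by simp)
  have h2 : MDifferentiableAt 𝓘(ℝ, F) 𝓘(ℝ, E) s ((1 : G) : G ⧸ K) :=
    hs.mdifferentiableAt (by simp)
  have h3 := mfderiv_comp_apply _ h1 h2 v
  have h4 : (fun a : G ↦ (a : G ⧸ K)) ∘ s =ᶠ[𝓝 ((1 : G) : G ⧸ K)] id := hsec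
  rw [h4.mfderiv_eq, mfderiv_id] at h3
  rw [hs1] at h3
  exact ⟨_, h3.symm⟩

end Quotient

/-! ### Smooth actions in charts -/

section ChartAction

variable {E F : Type*} [NormedAddCommGroup E] [NormedSpace ℝ E] [NormedAddCommGroup F]
  [NormedSpace ℝ F] {G : Type*} [TopologicalSpace G] [ChartedSpace E G] [Group G]
  {M : Type*} [TopologicalSpace M] [ChartedSpace F M] [MulAction G M]

/-- The action of `G` on `M` in the preferred charts at `1` and at `o`. -/
noncomputable def chartSmul (E F G : Type*) {M : Type*} [NormedAddCommGroup E] [NormedSpace ℝ E]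
    [NormedAddCommGroup F] [NormedSpace ℝ F] [TopologicalSpace G] [ChartedSpace E G] [Group G]
    [TopologicalSpace M] [ChartedSpace F M] [MulAction G M] (o : M) (p : E × F) : F :=
  extChartAt 𝓘(ℝ, F) o ((extChartAt 𝓘(ℝ, E) (1 : G)).symm p.1 • (extChartAt 𝓘(ℝ, F) o).symm p.2)

theorem eventually_chartSmul_one (o : M) :
    ∀ᶠ z in 𝓝 (extChartAt 𝓘(ℝ, F) o o),
      chartSmul E F G o (extChartAt 𝓘(ℝ, E) (1 : G) 1, z) = z := by
  filter_upwards [extChartAt_target_mem_nhds (I := 𝓘(ℝ, F)) o] with z hz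
  rw [chartSmul, extChartAt_to_inv, one_smul, PartialEquiv.right_inv _ hz]

theorem eventually_chartSmul_self_one :
    ∀ᶠ x in 𝓝 (extChartAt 𝓘(ℝ, E) (1 : G) 1),
      chartSmul E E G (1 : G) (x, extChartAt 𝓘(ℝ, E) (1 : G) 1) = x := by
  filter_upwards [extChartAt_target_mem_nhds (I := 𝓘(ℝ, E)) (1 : G)] with z hz
  rw [chartSmul, extChartAt_to_inv, smul_eq_mul, mul_one, PartialEquiv.right_inv _ hz]

variable [LieGroup 𝓘(ℝ, E) ∞ G] [IsManifold 𝓘(ℝ, F) ∞ M]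
  (hs : ContMDiff (𝓘(ℝ, E).prod 𝓘(ℝ, F)) 𝓘(ℝ, F) ∞ (fun p : G × M ↦ p.1 • p.2)) (o : M)

include hs

theorem contMDiffAt_chart_smul {p : E × F} (h1 : p.1 ∈ (extChartAt 𝓘(ℝ, E) (1 : G)).target)
    (h2 : p.2 ∈ (extChartAt 𝓘(ℝ, F) o).target) :
    ContMDiffAt 𝓘(ℝ, E × F) 𝓘(ℝ, F) ∞ (fun p : E × F ↦
      (extChartAt 𝓘(ℝ, E) (1 : G)).symm p.1 • (extChartAt 𝓘(ℝ, F) o).symm p.2) p := by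
  have h3 := (contMDiffAt_extChartAt_symm_of_mem h1).comp p
    (contDiff_fst (𝕜 := ℝ) (E := E) (F := F) (n := ∞)).contMDiff.contMDiffAt
  have h4 := (contMDiffAt_extChartAt_symm_of_mem h2).comp p
    (contDiff_snd (𝕜 := ℝ) (E := E) (F := F) (n := ∞)).contMDiff.contMDiffAt
  exact hs.contMDiffAt.comp p (h3.prodMk h4)

theorem contDiffAt_chartSmul_of_mem {p : E × F}
    (h1 : p.1 ∈ (extChartAt 𝓘(ℝ, E) (1 : G)).target)
    (h2 : p.2 ∈ (extChartAt 𝓘(ℝ, F) o).target)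
    (h3 : (extChartAt 𝓘(ℝ, E) (1 : G)).symm p.1 • (extChartAt 𝓘(ℝ, F) o).symm p.2 ∈
      (extChartAt 𝓘(ℝ, F) o).source) :
    ContDiffAt ℝ ∞ (chartSmul E F G o) p :=
  contMDiffAt_iff_contDiffAt.mp
    ((contMDiffAt_extChartAt_of_mem h3).comp p (contMDiffAt_chart_smul hs o h1 h2))

/-- Marks the region where the action in charts is faithful to the action, since all three points
lie in chart domains. -/
theorem eventually_chart_smul_mem :
    ∀ᶠ p : E × F in 𝓝 (extChartAt 𝓘(ℝ, E) (1 : G) 1, extChartAt 𝓘(ℝ, F) o o),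
      p.1 ∈ (extChartAt 𝓘(ℝ, E) (1 : G)).target ∧ p.2 ∈ (extChartAt 𝓘(ℝ, F) o).target ∧
      (extChartAt 𝓘(ℝ, E) (1 : G)).symm p.1 • (extChartAt 𝓘(ℝ, F) o).symm p.2 ∈
        (extChartAt 𝓘(ℝ, F) o).source := by
  have h1 := mem_extChartAt_target (I := 𝓘(ℝ, E)) (1 : G)
  have h2 := mem_extChartAt_target (I := 𝓘(ℝ, F)) o
  refine (continuousAt_fst.eventually_mem (extChartAt_target_mem_nhds (I := 𝓘(ℝ, E)) 1)).and
    ((continuousAt_snd.eventually_mem (extChartAt_target_mem_nhds (I := 𝓘(ℝ, F)) o)).and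
    ((contMDiffAt_chart_smul (p := (extChartAt 𝓘(ℝ, E) (1 : G) 1, extChartAt 𝓘(ℝ, F) o o))
      hs o h1 h2).continuousAt.eventually_mem ?_))
  simp only
  rw [extChartAt_to_inv, extChartAt_to_inv, one_smul]
  exact extChartAt_source_mem_nhds o

theorem contDiffAt_chartSmul : ContDiffAt ℝ ∞ (chartSmul E F G o)
    (extChartAt 𝓘(ℝ, E) (1 : G) 1, extChartAt 𝓘(ℝ, F) o o) := by
  obtain ⟨h1, h2, h3⟩ := (eventually_chart_smul_mem hs o).self_of_nhds
  exact contDiffAt_chartSmul_of_mem hs o h1 h2 h3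

omit hs in
theorem contDiffAt_chartMul : ContDiffAt ℝ ∞ (chartSmul E E G (1 : G))
    (extChartAt 𝓘(ℝ, E) (1 : G) 1, extChartAt 𝓘(ℝ, E) (1 : G) 1) :=
  contDiffAt_chartSmul (contMDiff_mul 𝓘(ℝ, E) ∞) 1

theorem eventually_chartSmul_assoc :
    ∀ᶠ p : (E × E) × F in 𝓝 ((extChartAt 𝓘(ℝ, E) (1 : G) 1, extChartAt 𝓘(ℝ, E) (1 : G) 1),
        extChartAt 𝓘(ℝ, F) o o),
      chartSmul E F G o (chartSmul E E G (1 : G) p.1, p.2) =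
        chartSmul E F G o (p.1.1, chartSmul E F G o (p.1.2, p.2)) := by
  have h1 := (continuousAt_fst (X := E × E) (Y := F) (p := ((extChartAt 𝓘(ℝ, E) (1 : G) 1,
    extChartAt 𝓘(ℝ, E) (1 : G) 1), extChartAt 𝓘(ℝ, F) o o))).eventually
    (eventually_chart_smul_mem (contMDiff_mul 𝓘(ℝ, E) ∞) (1 : G))
  have h2 := ((continuous_snd.comp continuous_fst).prodMk
    continuous_snd).continuousAt (X := (E × E) × F) (x := ((extChartAt 𝓘(ℝ, E) (1 : G) 1,
    extChartAt 𝓘(ℝ, E) (1 : G) 1), extChartAt 𝓘(ℝ, F) o o)).eventually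
    (eventually_chart_smul_mem hs o)
  filter_upwards [h1, h2] with p hp1 hp2
  simp only [chartSmul]
  rw [PartialEquiv.left_inv _ hp1.2.2,
    show p.1.2 = (Prod.snd ∘ Prod.fst) p from rfl, PartialEquiv.left_inv _ hp2.2.2, smul_eq_mul, mul_smul]

/-- The chain rule for φ⁻¹ ∘ Φ(p.1, ·) = a • φ⁻¹(·); it carries invariance of g over to the chart.
-/
theorem mfderiv_symm_fderiv_chartSmul {p : E × F}
    (h1 : p.1 ∈ (extChartAt 𝓘(ℝ, E) (1 : G)).target)
    (h2 : p.2 ∈ (extChartAt 𝓘(ℝ, F) o).target)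
    (h3 : (extChartAt 𝓘(ℝ, E) (1 : G)).symm p.1 • (extChartAt 𝓘(ℝ, F) o).symm p.2 ∈
      (extChartAt 𝓘(ℝ, F) o).source) (u : F) :
    (mfderiv 𝓘(ℝ, F) 𝓘(ℝ, F) (extChartAt 𝓘(ℝ, F) o).symm (chartSmul E F G o p)
      (fderiv ℝ (chartSmul E F G o) p (0, u)) : F) =
    mfderiv 𝓘(ℝ, F) 𝓘(ℝ, F) (fun x : M ↦ (extChartAt 𝓘(ℝ, E) (1 : G)).symm p.1 • x)
      ((extChartAt 𝓘(ℝ, F) o).symm p.2)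
      (mfderiv 𝓘(ℝ, F) 𝓘(ℝ, F) (extChartAt 𝓘(ℝ, F) o).symm p.2 u) := by
  set a := (extChartAt 𝓘(ℝ, E) (1 : G)).symm p.1 with ha
  have hmem : chartSmul E F G o p ∈ (extChartAt 𝓘(ℝ, F) o).target :=
    (extChartAt 𝓘(ℝ, F) o).map_source h3
  have hd := (contDiffAt_chartSmul_of_mem hs o h1 h2 h3).differentiableAt (by simp)
  have hd1 : HasFDerivAt (fun z ↦ chartSmul E F G o (p.1, z))
      ((fderiv ℝ (chartSmul E F G o) p).comp (ContinuousLinearMap.inr ℝ E F)) p.2 :=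
    HasFDerivAt.comp (g := chartSmul E F G o) (f := fun z ↦ (p.1, z)) p.2 hd.hasFDerivAt
      (hasFDerivAt_prodMk_right p.1 p.2)
  have hψ : MDifferentiableAt 𝓘(ℝ, F) 𝓘(ℝ, F) (extChartAt 𝓘(ℝ, F) o).symm p.2 :=
    (contMDiffAt_extChartAt_symm_of_mem h2).mdifferentiableAt (by simp)
  have hψ' : MDifferentiableAt 𝓘(ℝ, F) 𝓘(ℝ, F) (extChartAt 𝓘(ℝ, F) o).symm
      (chartSmul E F G o (p.1, p.2)) :=
    (contMDiffAt_extChartAt_symm_of_mem hmem).mdifferentiableAt (by simp)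
  have ha' : MDifferentiableAt 𝓘(ℝ, F) 𝓘(ℝ, F) (fun x : M ↦ a • x)
      ((extChartAt 𝓘(ℝ, F) o).symm p.2) :=
    (hs.contMDiffAt.comp _ (contMDiffAt_const.prodMk contMDiffAt_id)).mdifferentiableAt (by simp)
  have e1 := mfderiv_comp_apply p.2 hψ' hd1.differentiableAt.mdifferentiableAt u
  have e2 := mfderiv_comp_apply p.2 ha' hψ u
  have heq : (extChartAt 𝓘(ℝ, F) o).symm ∘ (fun z ↦ chartSmul E F G o (p.1, z)) =ᶠ[𝓝 p.2]
      (fun x : M ↦ a • x) ∘ (extChartAt 𝓘(ℝ, F) o).symm := by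
    have hc : ContinuousAt (fun z ↦ a • (extChartAt 𝓘(ℝ, F) o).symm z) p.2 :=
      ha'.continuousAt.comp hψ.continuousAt
    filter_upwards [hc.eventually ((isOpen_extChartAt_source o).mem_nhds h3)] with z hz
    exact (extChartAt 𝓘(ℝ, F) o).left_inv hz
  rw [heq.mfderiv_eq, mfderiv_eq_fderiv, hd1.fderiv] at e1
  exact e1.symm.trans e2

theorem eventually_inChart_chartSmul (g : SmoothMetric F M)
    (hg : ∀ (a : G) (x : M) (u v : TangentSpace 𝓘(ℝ, F) x),
      g.inner (a • x) (mfderiv 𝓘(ℝ, F) 𝓘(ℝ, F) (fun y : M ↦ a • y) x u)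
        (mfderiv 𝓘(ℝ, F) 𝓘(ℝ, F) (fun y : M ↦ a • y) x v) = g.inner x u v) :
    ∀ᶠ p : E × F in 𝓝 (extChartAt 𝓘(ℝ, E) (1 : G) 1, extChartAt 𝓘(ℝ, F) o o), ∀ u v,
      g.inChart o (chartSmul E F G o p) (fderiv ℝ (chartSmul E F G o) p (0, u))
        (fderiv ℝ (chartSmul E F G o) p (0, v)) = g.inChart o p.2 u v := by
  filter_upwards [eventually_chart_smul_mem hs o] with p ⟨h1, h2, h3⟩ u v
  -- Tangent spaces at different points are all the model space F, so the metrics at equal points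
  -- can be compared on the same vectors.
  have key : ∀ (x x' : M), x = x' → ∀ u v : F,
      (g.inner x : F →L[ℝ] F →L[ℝ] ℝ) u v = (g.inner x' : F →L[ℝ] F →L[ℝ] ℝ) u v := by
    rintro x _ rfl u v
    rfl
  have hp : (extChartAt 𝓘(ℝ, F) o).symm (chartSmul E F G o p) =
      (extChartAt 𝓘(ℝ, E) (1 : G)).symm p.1 • (extChartAt 𝓘(ℝ, F) o).symm p.2 :=
    (extChartAt 𝓘(ℝ, F) o).left_inv h3
  refine (key _ _ hp _ _).trans ?_
  refine Eq.trans ?_ (hg ((extChartAt 𝓘(ℝ, E) (1 : G)).symm p.1)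
    ((extChartAt 𝓘(ℝ, F) o).symm p.2) _ _)
  exact congrArg₂ (fun u v : F ↦ (g.inner _ : F →L[ℝ] F →L[ℝ] ℝ) u v)
    (mfderiv_symm_fderiv_chartSmul hs o h1 h2 h3 u) (mfderiv_symm_fderiv_chartSmul hs o h1 h2 h3 v)

end ChartAction

/-! ### The Lie bracket in a chart -/

section LieBracket

variable {E : Type*} [NormedAddCommGroup E] [NormedSpace ℝ E] {G : Type*} [TopologicalSpace G]
  [ChartedSpace E G] [Group G]

theorem mfderiv_extChartAt_symm_self {M : Type*} [TopologicalSpace M] [ChartedSpace E M]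
    [IsManifold 𝓘(ℝ, E) ∞ M] (x : M) :
    (mfderiv 𝓘(ℝ, E) 𝓘(ℝ, E) (extChartAt 𝓘(ℝ, E) x).symm (extChartAt 𝓘(ℝ, E) x x) : E →L[ℝ] E) =
      ContinuousLinearMap.id ℝ E := by
  have h := mfderivWithin_range_extChartAt_symm (I := 𝓘(ℝ, E)) (x := x)
  simp only [modelWithCornersSelf_coe, Set.range_id, mfderivWithin_univ] at h
  exact h

variable [LieGroup 𝓘(ℝ, E) ∞ G]

/-- The left-invariant field of v at a is the differential at 1 of left translation by a, applied to
v; in the chart this is the derivative of μ in its second variable. -/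
theorem eventually_mpullback_mulInvariantVectorField (v : GroupLieAlgebra 𝓘(ℝ, E) G) :
    VectorField.mpullback 𝓘(ℝ, E) 𝓘(ℝ, E) (extChartAt 𝓘(ℝ, E) (1 : G)).symm
        (mulInvariantVectorField v) =ᶠ[𝓝 (extChartAt 𝓘(ℝ, E) (1 : G) 1)]
      fun z ↦ fderiv ℝ (chartSmul E E G (1 : G)) (z, extChartAt 𝓘(ℝ, E) (1 : G) 1) (0, v) := by
  have h1 := (continuous_id.prodMk continuous_const).continuousAt (X := E)
    (x := extChartAt 𝓘(ℝ, E) (1 : G) 1).eventually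
    (eventually_chart_smul_mem (contMDiff_mul 𝓘(ℝ, E) ∞) (1 : G))
  filter_upwards [h1, eventually_chartSmul_self_one (G := G)] with z ⟨hz1, hz2, hz3⟩ hz4
  change z ∈ _ at hz1
  have h2 := mfderiv_symm_fderiv_chartSmul (contMDiff_mul 𝓘(ℝ, E) ∞) (1 : G)
    (p := (z, extChartAt 𝓘(ℝ, E) (1 : G) 1)) hz1 hz2 hz3 v
  have hinv : (mfderiv 𝓘(ℝ, E) 𝓘(ℝ, E) (extChartAt 𝓘(ℝ, E) (1 : G)).symm z).IsInvertible := by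
    have h := isInvertible_mfderivWithin_extChartAt_symm (I := 𝓘(ℝ, E)) hz1
    simpa only [modelWithCornersSelf_coe, Set.range_id, mfderivWithin_univ] using h
  have key : ∀ y : G, y = 1 → ∀ u : E,
      (mfderiv 𝓘(ℝ, E) 𝓘(ℝ, E) (fun x : G ↦ (extChartAt 𝓘(ℝ, E) (1 : G)).symm z • x) y u : E) =
        mulInvariantVectorField (I := 𝓘(ℝ, E)) u ((extChartAt 𝓘(ℝ, E) (1 : G)).symm z) := by
    rintro _ rfl u
    rfl
  rw [VectorField.mpullback_apply]
  refine hinv.inverse_apply_eq.mpr ?_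
  rw [hz4] at h2
  refine Eq.trans ?_ h2.symm
  refine Eq.trans ?_ (key _ (extChartAt_to_inv (I := 𝓘(ℝ, E)) (1 : G)) _).symm
  exact congrArg (fun u : E ↦ (mulInvariantVectorField (I := 𝓘(ℝ, E)) u
    ((extChartAt 𝓘(ℝ, E) (1 : G)).symm z) : E))
    (congrArg (fun f : E →L[ℝ] E ↦ f v) (mfderiv_extChartAt_symm_self (1 : G))).symm

theorem fderiv_fderiv_prodMk_apply {F : Type*} [NormedAddCommGroup F] [NormedSpace ℝ F]
    {f : E × E → F} {x y : E} (hf : ContDiffAt ℝ 2 f (x, y)) (u v : E) :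
    fderiv ℝ (fun z ↦ fderiv ℝ f (z, y) (0, v)) x u =
      fderiv ℝ (fderiv ℝ f) (x, y) (u, 0) (0, v) := by
  have h1 := (HasFDerivAt.comp (g := fderiv ℝ f) (f := fun z ↦ (z, y)) x hf.hasFDerivAt_fderiv
    (hasFDerivAt_prodMk_left x y)).clm_apply (hasFDerivAt_const ((0, v) : E × E) x)
  have h2 : fderiv ℝ (fun z ↦ fderiv ℝ f (z, y) (0, v)) x = _ := h1.fderiv
  rw [h2]
  simp

/-- The bracket at 1 of the left-invariant fields z ↦ ∂₂μ(z, e)v and z ↦ ∂₂μ(z, e)w, whose values at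
e are v and w. -/
theorem groupLieAlgebra_bracket_eq (v w : GroupLieAlgebra 𝓘(ℝ, E) G) :
    (⁅v, w⁆ : GroupLieAlgebra 𝓘(ℝ, E) G) =
      mixedDeriv (chartSmul E E G (1 : G)) (extChartAt 𝓘(ℝ, E) (1 : G) 1) v w -
        mixedDeriv (chartSmul E E G (1 : G)) (extChartAt 𝓘(ℝ, E) (1 : G) 1) w v := by
  have hμ := contDiffAt_chartMul (E := E) (G := G)
  have hV : ∀ v : E, fderiv ℝ (chartSmul E E G (1 : G)) (extChartAt 𝓘(ℝ, E) (1 : G) 1,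
      extChartAt 𝓘(ℝ, E) (1 : G) 1) (0, v) = v :=
    fderiv_apply_inr (hμ.differentiableAt (by simp)) (eventually_chartSmul_one (1 : G))
  have h2 : ContDiffAt ℝ 2 (chartSmul E E G (1 : G)) (extChartAt 𝓘(ℝ, E) (1 : G) 1,
      extChartAt 𝓘(ℝ, E) (1 : G) 1) := hμ.of_le ENat.LEInfty.out
  have h3 : VectorField.lieBracketWithin ℝ
      (VectorField.mpullbackWithin 𝓘(ℝ, E) 𝓘(ℝ, E) (extChartAt 𝓘(ℝ, E) (1 : G)).symm
        (mulInvariantVectorField v) (Set.range 𝓘(ℝ, E)))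
      (VectorField.mpullbackWithin 𝓘(ℝ, E) 𝓘(ℝ, E) (extChartAt 𝓘(ℝ, E) (1 : G)).symm
        (mulInvariantVectorField w) (Set.range 𝓘(ℝ, E)))
      ((extChartAt 𝓘(ℝ, E) (1 : G)).symm ⁻¹' Set.univ ∩ Set.range 𝓘(ℝ, E))
      (extChartAt 𝓘(ℝ, E) (1 : G) 1) =
      mixedDeriv (chartSmul E E G (1 : G)) (extChartAt 𝓘(ℝ, E) (1 : G) 1) v w -
        mixedDeriv (chartSmul E E G (1 : G)) (extChartAt 𝓘(ℝ, E) (1 : G) 1) w v := by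
    simp only [modelWithCornersSelf_coe, Set.range_id, Set.preimage_univ, Set.inter_univ,
      VectorField.mpullbackWithin_univ]
    refine (Filter.EventuallyEq.lieBracketWithin_vectorField_eq_nhds
      (eventually_mpullback_mulInvariantVectorField v)
      (eventually_mpullback_mulInvariantVectorField w)).trans ?_
    rw [VectorField.lieBracketWithin_univ, VectorField.lieBracket_eq]
    exact congrArg₂ (· - ·)
      ((congrArg _ (hV v)).trans (fderiv_fderiv_prodMk_apply h2 v w))
      ((congrArg _ (hV w)).trans (fderiv_fderiv_prodMk_apply h2 w v))
  have h4 : (mfderiv 𝓘(ℝ, E) 𝓘(ℝ, E) (extChartAt 𝓘(ℝ, E) (1 : G)) 1 : E →L[ℝ] E) =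
      ContinuousLinearMap.id ℝ E := mfderiv_extChartAt_self
  have h5 : ((ContinuousLinearMap.id ℝ E).inverse : E →L[ℝ] E) = ContinuousLinearMap.id ℝ E :=
    ContinuousLinearMap.inverse_id
  refine (VectorField.mlieBracketWithin_apply (I := 𝓘(ℝ, E)) (s := Set.univ)
    (V := mulInvariantVectorField v) (W := mulInvariantVectorField w) (x₀ := (1 : G))).trans ?_
  exact (congrArg (fun (f : E →L[ℝ] E) ↦ f.inverse _) h4).trans
    ((congrArg (fun (f : E →L[ℝ] E) ↦ f _) h5).trans h3)

end LieBracket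

/-! ### Fixed points of involutions -/

section InvolutionFixedCurve

/-- Near a fixed point an involution is conjugate to its differential, so the curve is the line tX
read in a linearising chart. -/
theorem exists_fixed_curve {E : Type*} [NormedAddCommGroup E] [NormedSpace ℝ E] [CompleteSpace E]
    {s : E → E} {e : E} (hs : ContDiffAt ℝ ∞ s e) (hse : s e = e)
    (hinv : ∀ᶠ x in 𝓝 e, s (s x) = x) {X : E} (hX : fderiv ℝ s e X = X) :
    ∃ c : ℝ → E, c 0 = e ∧ HasDerivAt c X 0 ∧
      ∀ᶠ t in 𝓝 0, ContinuousAt c t ∧ s (c t) = c t := by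
  set θ := fderiv ℝ s e with hθ
  have hsd : HasFDerivAt s θ e := (hs.differentiableAt (by simp)).hasFDerivAt
  have hθθ : ∀ v, θ (θ v) = v := by
    have h1 : HasFDerivAt (s ∘ s) (θ.comp θ) e := by
      refine HasFDerivAt.comp e ?_ hsd
      rwa [hse]
    have h2 := h1.unique ((hasFDerivAt_id e).congr_of_eventuallyEq hinv)
    intro v
    exact congrArg (fun f : E →L[ℝ] E ↦ f v) h2
  -- The average of x - e over the group generated by s. It intertwines s with θ, and its
  -- differential at e is ½(1 + θ²) = 1.
  let χ : E → E := fun x ↦ (2⁻¹ : ℝ) • ((x - e) + θ (s x - e))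
  have hχ : ContDiffAt ℝ ∞ χ e :=
    contDiffAt_const.smul ((contDiffAt_id.sub contDiffAt_const).add
      (θ.contDiff.contDiffAt.comp e (hs.sub contDiffAt_const)))
  have hχd : HasFDerivAt χ ((ContinuousLinearEquiv.refl ℝ E : E ≃L[ℝ] E) : E →L[ℝ] E) e := by
    have h1 := (((hasFDerivAt_id e).sub_const e).add
      (θ.hasFDerivAt.comp e (hsd.sub_const e))).const_smul (2⁻¹ : ℝ)
    refine h1.congr_fderiv ?_
    ext v
    change (2⁻¹ : ℝ) • (v + θ (θ v)) = v
    rw [hθθ, ← two_smul ℝ, smul_smul, inv_mul_cancel₀ two_ne_zero, one_smul]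
  have hχe : χ e = 0 := by simp [χ, hse]
  have hstrict := hχ.hasStrictFDerivAt' hχd (by simp)
  have hχs : ∀ᶠ x in 𝓝 e, χ (s x) = θ (χ x) := by
    filter_upwards [hinv] with x hx
    simp only [χ, map_smul, map_add, hθθ, hx]
    rw [add_comm]
  have hl : ContDiffAt ℝ ∞ (hstrict.localInverse χ _ e) (χ e) :=
    hχ.to_localInverse hχd (by simp)
  let c : ℝ → E := fun t ↦ hstrict.localInverse χ _ e (t • X)
  have hc0 : c 0 = e := by
    have h1 := hstrict.localInverse_apply_image
    rw [hχe] at h1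
    simpa [c] using h1
  have hcd : ContDiffAt ℝ 1 c 0 := by
    refine ContDiffAt.comp (0 : ℝ) (g := hstrict.localInverse χ _ e) ?_
      (contDiffAt_id.smul contDiffAt_const)
    rw [hχe] at hl
    simpa using hl.of_le (by simp)
  have hcder : HasDerivAt c X 0 := by
    have h1 := hstrict.to_localInverse.hasFDerivAt
    have h2 : HasDerivAt (fun t : ℝ ↦ t • X) X 0 := by
      simpa using (hasDerivAt_id (0 : ℝ)).smul_const X
    have h3 := HasFDerivAt.comp_hasDerivAt (0 : ℝ) (l := hstrict.localInverse χ _ e)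
      (l' := ((ContinuousLinearEquiv.refl ℝ E).symm : E →L[ℝ] E)) (by
        rw [hχe] at h1
        simpa using h1) h2
    exact h3
  have hct : Filter.Tendsto c (𝓝 0) (𝓝 e) := by
    simpa [ContinuousAt, hc0] using hcd.continuousAt
  have hst : Filter.Tendsto (fun t ↦ s (c t)) (𝓝 0) (𝓝 e) := by
    have h1 := hs.continuousAt.tendsto.comp hct
    rwa [hse] at h1
  refine ⟨c, hc0, hcder, ?_⟩
  have hright : ∀ᶠ t : ℝ in 𝓝 0, χ (c t) = t • X := by
    have h1 := hstrict.eventually_right_inverse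
    rw [hχe] at h1
    have h2 : Filter.Tendsto (fun t : ℝ ↦ t • X) (𝓝 0) (𝓝 0) := by
      have : Continuous (fun t : ℝ ↦ t • X) := by fun_prop
      simpa using this.tendsto 0
    exact h2.eventually h1
  filter_upwards [hcd.eventually (by simp), hst.eventually hstrict.eventually_left_inverse,
    hct.eventually hχs, hright] with t h1 h2 h3 h4
  refine ⟨h1.continuousAt, ?_⟩
  -- s(c t) = χ⁻¹(χ(s(c t))) = χ⁻¹(θ(tX)) = χ⁻¹(tX) = c t.
  rw [← h2, h3, h4, map_smul, hX]

end InvolutionFixedCurve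

/-! ### The differential of an involutive automorphism. -/

section Automorphism

variable {E : Type*} [NormedAddCommGroup E] [NormedSpace ℝ E] {G : Type*} [TopologicalSpace G]
  [ChartedSpace E G] [Group G]

/-- A map of a Lie group to itself in the preferred chart at `1`. -/
noncomputable def chartMap (E : Type*) {G : Type*} [NormedAddCommGroup E] [NormedSpace ℝ E] [TopologicalSpace G]
    [ChartedSpace E G] [Group G] (σ : G → G) (x : E) : E :=
  extChartAt 𝓘(ℝ, E) (1 : G) (σ ((extChartAt 𝓘(ℝ, E) (1 : G)).symm x))

variable (σ : G ≃* G)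

theorem chartMap_self : chartMap E σ (extChartAt 𝓘(ℝ, E) (1 : G) 1) =
    extChartAt 𝓘(ℝ, E) (1 : G) 1 := by
  rw [chartMap, extChartAt_to_inv, map_one]

variable [LieGroup 𝓘(ℝ, E) ∞ G] (hσ : ContMDiff 𝓘(ℝ, E) 𝓘(ℝ, E) ∞ σ)

include hσ

theorem contMDiffAt_comp_extChartAt_symm : ContMDiffAt 𝓘(ℝ, E) 𝓘(ℝ, E) ∞
    (fun x ↦ σ ((extChartAt 𝓘(ℝ, E) (1 : G)).symm x)) (extChartAt 𝓘(ℝ, E) (1 : G) 1) :=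
  hσ.contMDiffAt.comp _ (contMDiffAt_extChartAt_symm_of_mem (mem_extChartAt_target _))

theorem contDiffAt_chartMap : ContDiffAt ℝ ∞ (chartMap E σ) (extChartAt 𝓘(ℝ, E) (1 : G) 1) := by
  refine contMDiffAt_iff_contDiffAt.mp (ContMDiffAt.comp (extChartAt 𝓘(ℝ, E) (1 : G) 1)
    (contMDiffAt_extChartAt_of_mem ?_) (contMDiffAt_comp_extChartAt_symm σ hσ))
  rw [extChartAt_to_inv, map_one]
  exact mem_extChartAt_source _

theorem eventually_symm_chartMap : ∀ᶠ x in 𝓝 (extChartAt 𝓘(ℝ, E) (1 : G) 1),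
    (extChartAt 𝓘(ℝ, E) (1 : G)).symm (chartMap E σ x) =
      σ ((extChartAt 𝓘(ℝ, E) (1 : G)).symm x) := by
  have h := (contMDiffAt_comp_extChartAt_symm σ hσ).continuousAt.eventually_mem
    (s := (extChartAt 𝓘(ℝ, E) (1 : G)).source) (by
      rw [extChartAt_to_inv, map_one]
      exact extChartAt_source_mem_nhds _)
  filter_upwards [h] with x hx
  exact (extChartAt 𝓘(ℝ, E) (1 : G)).left_inv hx

theorem eventually_chartMap_chartMap (hinv : ∀ a, σ (σ a) = a) :
    ∀ᶠ x in 𝓝 (extChartAt 𝓘(ℝ, E) (1 : G) 1), chartMap E σ (chartMap E σ x) = x := by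
  filter_upwards [eventually_symm_chartMap σ hσ, extChartAt_target_mem_nhds (I := 𝓘(ℝ, E)) (1 : G)]
    with x h1 h2
  rw [chartMap, h1, hinv, (extChartAt 𝓘(ℝ, E) (1 : G)).right_inv h2]

theorem eventually_chartMap_chartSmul :
    ∀ᶠ p in 𝓝 (extChartAt 𝓘(ℝ, E) (1 : G) 1, extChartAt 𝓘(ℝ, E) (1 : G) 1),
      chartMap E σ (chartSmul E E G (1 : G) p) =
        chartSmul E E G (1 : G) (chartMap E σ p.1, chartMap E σ p.2) := by
  have h := eventually_symm_chartMap σ hσ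
  filter_upwards [eventually_chart_smul_mem (contMDiff_mul 𝓘(ℝ, E) ∞) (1 : G),
    continuousAt_fst.eventually h, continuousAt_snd.eventually h] with p ⟨_, _, h1⟩ h2 h3
  simp only [chartSmul]
  rw [h2, h3, chartMap, PartialEquiv.left_inv _ h1, smul_eq_mul, map_mul, smul_eq_mul]

theorem fderiv_chartMap_fderiv_chartMap (hinv : ∀ a, σ (σ a) = a) (X : E) :
    fderiv ℝ (chartMap E σ) (extChartAt 𝓘(ℝ, E) (1 : G) 1)
      (fderiv ℝ (chartMap E σ) (extChartAt 𝓘(ℝ, E) (1 : G) 1) X) = X := by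
  have h := ((contDiffAt_chartMap σ hσ).differentiableAt (by simp)).hasFDerivAt
  have h1 := HasFDerivAt.comp (g := chartMap E σ) (extChartAt 𝓘(ℝ, E) (1 : G) 1)
    (by rw [chartMap_self]; exact h) h
  have h2 := h1.unique ((hasFDerivAt_id _).congr_of_eventuallyEq
    (eventually_chartMap_chartMap σ hσ hinv))
  exact congrArg (fun f : E →L[ℝ] E ↦ f X) h2

variable [CompleteSpace E]

/-- The differential at `1` of an involutive automorphism of a Lie group. -/
noncomputable def involutionDifferential (hinv : ∀ a, σ (σ a) = a) :
    GroupLieAlgebra 𝓘(ℝ, E) G ≃ₗ⁅ℝ⁆ GroupLieAlgebra 𝓘(ℝ, E) G where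
  toFun X := fderiv ℝ (chartMap E σ) (extChartAt 𝓘(ℝ, E) (1 : G) 1) X
  invFun X := fderiv ℝ (chartMap E σ) (extChartAt 𝓘(ℝ, E) (1 : G) 1) X
  map_add' X Y := map_add (fderiv ℝ (chartMap E σ) (extChartAt 𝓘(ℝ, E) (1 : G) 1)) X Y
  map_smul' c X := map_smul (fderiv ℝ (chartMap E σ) (extChartAt 𝓘(ℝ, E) (1 : G) 1)) c X
  map_lie' {X Y} := by
    have h := fderiv_mixedDeriv_bracket contDiffAt_chartMul (contDiffAt_chartMap σ hσ)
      (chartMap_self σ) (eventually_chartSmul_one (1 : G)) eventually_chartSmul_self_one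
      (eventually_chartMap_chartSmul σ hσ) X Y
    refine (congrArg _ (groupLieAlgebra_bracket_eq X Y)).trans (h.trans ?_)
    exact (groupLieAlgebra_bracket_eq _ _).symm
  left_inv X := fderiv_chartMap_fderiv_chartMap σ hσ hinv X
  right_inv X := fderiv_chartMap_fderiv_chartMap σ hσ hinv X

end Automorphism

/-! ### Velocities of curves in charts. -/

section Velocities

variable {E : Type*} [NormedAddCommGroup E] [NormedSpace ℝ E] {M : Type*} [TopologicalSpace M]
  [ChartedSpace E M] [IsManifold 𝓘(ℝ, E) ∞ M]

/-- The chart at x has identity differential at x, so tangent velocity and chart velocity coincide.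
-/
theorem hasDerivAt_extChartAt_comp {γ : ℝ → M} {x : M} (h0 : γ 0 = x)
    (hγ : MDifferentiableAt 𝓘(ℝ, ℝ) 𝓘(ℝ, E) γ 0) :
    HasDerivAt (fun t ↦ extChartAt 𝓘(ℝ, E) x (γ t)) (mfderiv 𝓘(ℝ, ℝ) 𝓘(ℝ, E) γ 0 (1 : ℝ)) 0 := by
  subst h0
  have h1 : MDifferentiableAt 𝓘(ℝ, E) 𝓘(ℝ, E) (extChartAt 𝓘(ℝ, E) (γ 0)) (γ 0) :=
    (contMDiffAt_extChartAt_of_mem (mem_extChartAt_source _)).mdifferentiableAt (by simp)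
  have h2 : DifferentiableAt ℝ (fun t ↦ extChartAt 𝓘(ℝ, E) (γ 0) (γ t)) 0 :=
    (h1.comp 0 hγ).differentiableAt
  have h3 := mfderiv_comp_apply (0 : ℝ) h1 hγ (1 : ℝ)
  rw [mfderiv_extChartAt_self, mfderiv_eq_fderiv] at h3
  exact h3 ▸ h2.hasFDerivAt.hasDerivAt

theorem mdifferentiableAt_of_chart {γ : ℝ → M} {c : ℝ → E} {x : M} {X : E}
    (hc0 : c 0 = extChartAt 𝓘(ℝ, E) x x) (hc : HasDerivAt c X 0)
    (hγ : ∀ᶠ t in 𝓝 0, γ t = (extChartAt 𝓘(ℝ, E) x).symm (c t)) :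
    MDifferentiableAt 𝓘(ℝ, ℝ) 𝓘(ℝ, E) γ 0 ∧
      (mfderiv 𝓘(ℝ, ℝ) 𝓘(ℝ, E) γ 0 (1 : ℝ) : E) = X := by
  have hmem : c 0 ∈ (extChartAt 𝓘(ℝ, E) x).target := hc0 ▸ mem_extChartAt_target x
  have h1 : MDifferentiableAt 𝓘(ℝ, ℝ) 𝓘(ℝ, E)
      (fun t ↦ (extChartAt 𝓘(ℝ, E) x).symm (c t)) 0 :=
    MDifferentiableAt.comp (0 : ℝ)
      ((contMDiffAt_extChartAt_symm_of_mem hmem).mdifferentiableAt (by simp))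
      hc.differentiableAt.mdifferentiableAt
  have h2 : MDifferentiableAt 𝓘(ℝ, ℝ) 𝓘(ℝ, E) γ 0 := h1.congr_of_eventuallyEq hγ
  refine ⟨h2, ?_⟩
  have h0 : γ 0 = x := by rw [hγ.self_of_nhds, hc0, extChartAt_to_inv]
  refine (hasDerivAt_extChartAt_comp h0 h2).unique (hc.congr_of_eventuallyEq ?_)
  filter_upwards [hγ, hc.continuousAt.eventually_mem (extChartAt_target_mem_nhds_of_mem hmem)]
    with t ht ht'
  rw [ht, (extChartAt 𝓘(ℝ, E) x).right_inv ht']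

end Velocities

/-! ### The Lie algebra of the identity component of the fixed subgroup. -/

section IdentityComponent

/-- The image of the interval is a connected subset of the fixed subgroup that contains 1. -/
theorem mem_fixedIdentityComponent_of_curve {G : Type*} [TopologicalSpace G] [Group G]
    [IsTopologicalGroup G] (σ : G ≃* G) {γ : ℝ → G} {ε : ℝ} (hγ0 : γ 0 = 1)
    (hγ : ∀ t ∈ Set.Ioo (-ε) ε, ContinuousAt γ t ∧ σ (γ t) = γ t) {t : ℝ}
    (ht : t ∈ Set.Ioo (-ε) ε) : γ t ∈ fixedIdentityComponent σ := by
  have hε : (0 : ℝ) ∈ Set.Ioo (-ε) ε := by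
    have := ht.1.trans ht.2
    constructor <;> linarith
  let f : Set.Ioo (-ε) ε → σ.toMonoidHom.eqLocus (MonoidHom.id G) :=
    fun t ↦ ⟨γ t, (hγ t t.2).2⟩
  have hf : Continuous f := by
    refine Continuous.subtype_mk (continuous_iff_continuousAt.mpr fun t ↦ ?_) _
    exact (hγ t t.2).1.comp continuousAt_subtype_val
  have hpc : PreconnectedSpace (Set.Ioo (-ε) ε) := isPreconnected_iff_preconnectedSpace.mp
    isPreconnected_Ioo
  refine ⟨f ⟨t, ht⟩, ?_, rfl⟩
  refine (isPreconnected_range hf).subset_connectedComponent ⟨⟨0, hε⟩, ?_⟩ ⟨⟨t, ht⟩, rfl⟩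
  exact Subtype.ext hγ0

variable {E : Type*} [NormedAddCommGroup E] [NormedSpace ℝ E] [CompleteSpace E]
  {G : Type*} [TopologicalSpace G] [ChartedSpace E G] [Group G] [LieGroup 𝓘(ℝ, E) ∞ G]
  [IsTopologicalGroup G] (σ : G ≃* G) (hσ : ContMDiff 𝓘(ℝ, E) 𝓘(ℝ, E) ∞ σ)
  (hinv : ∀ a, σ (σ a) = a)

theorem apply_eq_self_of_mem_fixedIdentityComponent {σ : G ≃* G} {a : G}
    (ha : a ∈ fixedIdentityComponent σ) : σ a = a := by
  obtain ⟨b, _, rfl⟩ := ha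
  exact b.2

include hσ hinv

theorem exists_curve_fixedIdentityComponent {X : E}
    (hX : fderiv ℝ (chartMap E σ) (extChartAt 𝓘(ℝ, E) (1 : G) 1) X = X) :
    ∃ γ : ℝ → G, (∀ t, γ t ∈ fixedIdentityComponent σ) ∧ γ 0 = 1 ∧
      MDifferentiableAt 𝓘(ℝ, ℝ) 𝓘(ℝ, E) γ 0 ∧
      (mfderiv 𝓘(ℝ, ℝ) 𝓘(ℝ, E) γ 0 (1 : ℝ) : E) = X := by
  obtain ⟨c, hc0, hcX, hc⟩ := exists_fixed_curve (contDiffAt_chartMap σ hσ) (chartMap_self σ)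
    (eventually_chartMap_chartMap σ hσ hinv) hX
  have hct : Filter.Tendsto c (𝓝 0) (𝓝 (extChartAt 𝓘(ℝ, E) (1 : G) 1)) := by
    simpa only [ContinuousAt, hc0] using hcX.continuousAt
  have hev : ∀ᶠ t in 𝓝 (0 : ℝ),
      ContinuousAt (fun t ↦ (extChartAt 𝓘(ℝ, E) (1 : G)).symm (c t)) t ∧
      σ ((extChartAt 𝓘(ℝ, E) (1 : G)).symm (c t)) = (extChartAt 𝓘(ℝ, E) (1 : G)).symm (c t) := by
    filter_upwards [hc, hct.eventually (eventually_symm_chartMap σ hσ),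
      hct.eventually_mem (extChartAt_target_mem_nhds (I := 𝓘(ℝ, E)) (1 : G))] with t h1 h2 h3
    refine ⟨(continuousAt_extChartAt_symm'' h3).comp h1.1, ?_⟩
    rw [← h2, h1.2]
  obtain ⟨ε, hε, hball⟩ := Metric.eventually_nhds_iff_ball.mp hev
  rw [Real.ball_eq_Ioo, zero_sub, zero_add] at hball
  have h0 : (extChartAt 𝓘(ℝ, E) (1 : G)).symm (c 0) = 1 := by rw [hc0, extChartAt_to_inv]
  -- The curve must stay in the subgroup for all times but be differentiable only at 0, so the value
  -- 1 is assigned where fixedness is not known.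
  let γ : ℝ → G := fun t ↦ open Classical in
    if t ∈ Set.Ioo (-ε) ε then (extChartAt 𝓘(ℝ, E) (1 : G)).symm (c t) else 1
  have hγ : ∀ᶠ t in 𝓝 0, γ t = (extChartAt 𝓘(ℝ, E) (1 : G)).symm (c t) := by
    filter_upwards [Ioo_mem_nhds (neg_neg_of_pos hε) hε] with t ht
    exact if_pos ht
  refine ⟨γ, fun t ↦ ?_, by rw [hγ.self_of_nhds, h0], mdifferentiableAt_of_chart hc0 hcX hγ⟩
  by_cases ht : t ∈ Set.Ioo (-ε) ε
  · simp only [γ, if_pos ht]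
    exact mem_fixedIdentityComponent_of_curve σ h0 hball ht
  · simp only [γ, if_neg ht, one_mem]

theorem mem_subgroupLieAlgebra_fixedIdentityComponent_iff (X : GroupLieAlgebra 𝓘(ℝ, E) G) :
    X ∈ subgroupLieAlgebra (E := E) (fixedIdentityComponent σ) ↔
      involutionDifferential σ hσ hinv X = X := by
  constructor
  · let θ := involutionDifferential σ hσ hinv
    -- The fixed space of θ is a subalgebra, so a bound on velocities passes to the subalgebra they
    -- generate.
    let S : LieSubalgebra ℝ (GroupLieAlgebra 𝓘(ℝ, E) G) :=
      { carrier := {X | θ X = X}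
        add_mem' := fun {X Y} hX hY ↦ by
          change θ (X + Y) = X + Y
          rw [map_add, show θ X = X from hX, show θ Y = Y from hY]
        zero_mem' := map_zero θ
        smul_mem' := fun c X hX ↦ by
          change θ (c • X) = c • X
          rw [map_smul, show θ X = X from hX]
        lie_mem' := fun {X Y} hX hY ↦ by
          change θ ⁅X, Y⁆ = ⁅X, Y⁆
          rw [LieEquiv.map_lie, show θ X = X from hX, show θ Y = Y from hY] }
    suffices h : subgroupLieAlgebra (E := E) (fixedIdentityComponent σ) ≤ S from fun hX ↦ h hX
    refine LieSubalgebra.lieSpan_le.mpr ?_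
    rintro X ⟨γ, hγK, hγ0, hγd, hγX⟩
    have h1 := hasDerivAt_extChartAt_comp hγ0 hγd
    rw [hγX] at h1
    have hct : Filter.Tendsto γ (𝓝 0) (𝓝 1) := by
      simpa only [ContinuousAt, hγ0] using hγd.continuousAt
    have hs := ((contDiffAt_chartMap σ hσ).differentiableAt (by simp)).hasFDerivAt
    have h2 := HasFDerivAt.comp_hasDerivAt (0 : ℝ) (l := chartMap E σ) (by rw [hγ0]; exact hs) h1
    refine h2.unique (h1.congr_of_eventuallyEq ?_)
    filter_upwards [hct.eventually_mem (extChartAt_source_mem_nhds (I := 𝓘(ℝ, E)) (1 : G))]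
      with t ht
    rw [Function.comp_apply, chartMap, PartialEquiv.left_inv _ ht,
      apply_eq_self_of_mem_fixedIdentityComponent (hγK t)]
  · intro hX
    exact LieSubalgebra.subset_lieSpan (exists_curve_fixedIdentityComponent σ hσ hinv hX)

end IdentityComponent

/-! ### The symmetric space of an involution -/

section TangentModel

variable {L : Type*} [LieRing L] [LieAlgebra ℝ L] {V : Type*} [AddCommGroup V] [Module ℝ V]
  {θ : L ≃ₗ⁅ℝ⁆ L} {𝔥 : LieSubalgebra ℝ L} {b : LinearMap.BilinForm ℝ V} {pr : L →ₗ[ℝ] V}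

/-- On the -1 eigenspace `pr` carries b to -B, which is nondegenerate there, so `pr` is injective on
it; it is surjective because it kills the +1 eigenspace. The inclusion s inverts it. -/
theorem IsSymmetricPair.exists_isTangentModel [LieAlgebra.IsKilling ℝ L]
    (h : IsSymmetricPair θ 𝔥) (hpr : Function.Surjective pr) (hpr0 : ∀ X, θ X = X → pr X = 0)
    (hb : ∀ X Y, θ X = -X → θ Y = -Y → b (pr X) (pr Y) = -killingForm ℝ L X Y) :
    ∃ s : V →ₗ[ℝ] L, IsTangentModel θ b pr s := by
  let q : L →ₗ[ℝ] L := (2⁻¹ : ℝ) • (LinearMap.id - (θ : L →ₗ[ℝ] L))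
  have hq : ∀ X, q X = (2⁻¹ : ℝ) • (X - θ X) := fun X ↦ rfl
  have hθq : ∀ X, θ (q X) = -q X := fun X ↦ by
    rw [hq, map_smul, map_sub, h.involutive, ← smul_neg, neg_sub]
  have hprq : ∀ X, pr (q X) = pr X := fun X ↦ by
    have h1 := hpr0 (X + θ X) (by rw [map_add, h.involutive, add_comm])
    rw [map_add, add_comm] at h1
    rw [hq, map_smul, map_sub, eq_neg_of_add_eq_zero_left h1, sub_neg_eq_add, ← two_smul ℝ,
      smul_smul, inv_mul_cancel₀ two_ne_zero, one_smul]
  have hq0 : ∀ X, pr X = 0 → q X = 0 := fun X hX ↦ h.neg_eq_zero (hθq X) fun Y hY ↦ by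
    have h1 := hb (q X) Y (hθq X) hY
    rw [hprq, hX, map_zero, LinearMap.zero_apply] at h1
    exact _root_.neg_eq_zero.mp h1.symm
  -- Any right inverse r will do: q removes its 𝔥-component and leaves its image under `pr`
  -- unchanged.
  obtain ⟨r, hr⟩ := pr.exists_rightInverse_of_surjective (LinearMap.range_eq_top.mpr hpr)
  have hr' : ∀ v, pr (r v) = v := fun v ↦ congrArg (fun f : V →ₗ[ℝ] V ↦ f v) hr
  refine ⟨q ∘ₗ r, fun v ↦ hθq _, fun v ↦ (hprq _).trans (hr' v), fun X ↦ ?_, fun v w ↦ ?_⟩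
  · have h1 := hq0 (r (pr X) - X) (by rw [map_sub, hr', sub_self])
    rw [map_sub, sub_eq_zero] at h1
    rw [LinearMap.comp_apply, h1, hq, smul_smul, mul_inv_cancel₀ two_ne_zero, one_smul]
  · have h1 := hb (q (r v)) (q (r w)) (hθq _) (hθq _)
    rwa [hprq, hprq, hr', hr'] at h1

end TangentModel

/-! ### The differential of the projection and the action fields at the base point. -/

section ProjDeriv

variable {E F : Type*} [NormedAddCommGroup E] [NormedSpace ℝ E] [NormedAddCommGroup F]
  [NormedSpace ℝ F] {G : Type*} [TopologicalSpace G] [ChartedSpace E G] [Group G]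
  {K : Subgroup G} [ChartedSpace F (G ⧸ K)]

theorem hasFDerivAt_projDeriv
    (hπ : IsSubmersion 𝓘(ℝ, E) 𝓘(ℝ, F) ∞ (fun a : G ↦ (a : G ⧸ K))) :
    HasFDerivAt (fun x ↦ extChartAt 𝓘(ℝ, F) ((1 : G) : G ⧸ K)
      (((extChartAt 𝓘(ℝ, E) (1 : G)).symm x : G) : G ⧸ K)) (projDeriv E F K : E →L[ℝ] F)
      (extChartAt 𝓘(ℝ, E) (1 : G) 1) := by
  have h1 : MDifferentiableAt 𝓘(ℝ, E) 𝓘(ℝ, F) (fun a : G ↦ (a : G ⧸ K)) 1 :=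
    (hπ.isSubmersionAt 1).contMDiffAt.mdifferentiableAt (by simp)
  have h2 := h1.hasMFDerivAt.2
  rw [modelWithCornersSelf_coe, Set.range_id] at h2
  exact hasFDerivWithinAt_univ.mp h2

/-- The orbit map of the base point is the projection π. -/
theorem actionField_chartSmul [LieGroup 𝓘(ℝ, E) ∞ G] [IsManifold 𝓘(ℝ, F) ∞ (G ⧸ K)]
    (hπ : IsSubmersion 𝓘(ℝ, E) 𝓘(ℝ, F) ∞ (fun a : G ↦ (a : G ⧸ K))) (X : E) :
    actionField (chartSmul E F G ((1 : G) : G ⧸ K)) (extChartAt 𝓘(ℝ, E) (1 : G) 1) X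
      (extChartAt 𝓘(ℝ, F) ((1 : G) : G ⧸ K) ((1 : G) : G ⧸ K)) = projDeriv E F K X := by
  have h1 := ((contDiffAt_chartSmul (contMDiff_quotient_smul hπ)
    ((1 : G) : G ⧸ K)).differentiableAt (by simp)).hasFDerivAt
  have h2 := HasFDerivAt.comp (g := chartSmul E F G ((1 : G) : G ⧸ K)) (f := fun x ↦
    (x, extChartAt 𝓘(ℝ, F) ((1 : G) : G ⧸ K) ((1 : G) : G ⧸ K)))
    (extChartAt 𝓘(ℝ, E) (1 : G) 1) h1 (hasFDerivAt_prodMk_left _ _)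
  have h3 : chartSmul E F G ((1 : G) : G ⧸ K) ∘ (fun x ↦
      (x, extChartAt 𝓘(ℝ, F) ((1 : G) : G ⧸ K) ((1 : G) : G ⧸ K))) =
      fun x ↦ extChartAt 𝓘(ℝ, F) ((1 : G) : G ⧸ K)
        (((extChartAt 𝓘(ℝ, E) (1 : G)).symm x : G) : G ⧸ K) := by
    ext x
    rw [Function.comp_apply, chartSmul, extChartAt_to_inv, MulAction.Quotient.smul_coe,
      smul_eq_mul, mul_one]
  rw [h3] at h2
  exact congrArg (fun f : E →L[ℝ] F ↦ f X) (h2.unique (hasFDerivAt_projDeriv hπ))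

/-- The projection is constant along a curve in K. -/
theorem projDeriv_eq_zero_of_curve [IsManifold 𝓘(ℝ, E) ∞ G]
    (hπ : IsSubmersion 𝓘(ℝ, E) 𝓘(ℝ, F) ∞ (fun a : G ↦ (a : G ⧸ K))) {γ : ℝ → G} {X : E}
    (hγK : ∀ t, γ t ∈ K) (hγ0 : γ 0 = 1) (hγ : MDifferentiableAt 𝓘(ℝ, ℝ) 𝓘(ℝ, E) γ 0)
    (hX : (mfderiv 𝓘(ℝ, ℝ) 𝓘(ℝ, E) γ 0 (1 : ℝ) : E) = X) : projDeriv E F K X = 0 := by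
  have h1 := hasDerivAt_extChartAt_comp hγ0 hγ
  rw [hX] at h1
  have hct : Filter.Tendsto γ (𝓝 0) (𝓝 1) := by
    simpa only [ContinuousAt, hγ0] using hγ.continuousAt
  have h2 := HasFDerivAt.comp_hasDerivAt (0 : ℝ) (l := fun x ↦ extChartAt 𝓘(ℝ, F)
    ((1 : G) : G ⧸ K) (((extChartAt 𝓘(ℝ, E) (1 : G)).symm x : G) : G ⧸ K))
    (by rw [hγ0]; exact hasFDerivAt_projDeriv hπ) h1
  refine h2.unique ((hasDerivAt_const (0 : ℝ)
    (extChartAt 𝓘(ℝ, F) ((1 : G) : G ⧸ K) ((1 : G) : G ⧸ K))).congr_of_eventuallyEq ?_)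
  filter_upwards [hct.eventually_mem (extChartAt_source_mem_nhds (I := 𝓘(ℝ, E)) (1 : G))]
    with t ht
  rw [Function.comp_apply, PartialEquiv.left_inv _ ht]
  congr 1
  exact QuotientGroup.eq.mpr (by simpa using hγK t)

end ProjDeriv

/-! ### The curvature tensor at the centre of the chart. -/

section Riemann

variable {F : Type*} [NormedAddCommGroup F] [NormedSpace ℝ F] {M : Type*} [TopologicalSpace M]
  [ChartedSpace F M] [IsManifold 𝓘(ℝ, F) ∞ M]

theorem inChart_self (g : SmoothMetric F M) (x : M) (u v : F) :
    g.inChart x (extChartAt 𝓘(ℝ, F) x x) u v = g.form x u v := by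
  have key : ∀ x' : M, x' = x → ∀ u v : F,
      (g.inner x' : F →L[ℝ] F →L[ℝ] ℝ) u v = g.form x u v := by
    rintro _ rfl u v
    rfl
  have h := mfderiv_extChartAt_symm_self (E := F) x
  refine Eq.trans ?_ (key _ (extChartAt_to_inv (I := 𝓘(ℝ, F)) x) u v)
  exact congrArg (fun f : F →L[ℝ] F ↦ (g.inner ((extChartAt 𝓘(ℝ, F) x).symm
    (extChartAt 𝓘(ℝ, F) x x)) : F →L[ℝ] F →L[ℝ] ℝ) (f u) (f v)) h

/-- Both the chart at x and its inverse have identity differential at the base point, so all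
coordinate changes disappear. -/
theorem riemann_apply (g : SmoothMetric F M) (x : M) (X Y Z W : F) :
    g.riemann x X Y Z W = g.form x
      (curvatureEndo (E := F) (g.inChart x) (extChartAt 𝓘(ℝ, F) x x) X Y W) Z := by
  have h : (mfderiv 𝓘(ℝ, F) 𝓘(ℝ, F) (extChartAt 𝓘(ℝ, F) x) x : F →L[ℝ] F) =
      ContinuousLinearMap.id ℝ F := mfderiv_extChartAt_self
  have key : ∀ D : F →L[ℝ] F, D = ContinuousLinearMap.id ℝ F →
      g.inChart x (extChartAt 𝓘(ℝ, F) x x) (curvatureEndo (g.inChart x)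
        (extChartAt 𝓘(ℝ, F) x x) (D X) (D Y) (D W)) (D Z) = g.form x
      (curvatureEndo (E := F) (g.inChart x) (extChartAt 𝓘(ℝ, F) x x) X Y W) Z := by
    rintro _ rfl
    exact inChart_self g x _ _
  exact key _ h

end Riemann

/-! ### The curvature of the homogeneous space. -/

section SymmetricSpace

variable {E F : Type*} [NormedAddCommGroup E] [NormedSpace ℝ E]
  [NormedAddCommGroup F] [NormedSpace ℝ F] [FiniteDimensional ℝ F] [CompleteSpace F]
  {G : Type*} [TopologicalSpace G] [ChartedSpace E G] [Group G] [LieGroup 𝓘(ℝ, E) ∞ G]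
  {K : Subgroup G} [ChartedSpace F (G ⧸ K)] [IsManifold 𝓘(ℝ, F) ∞ (G ⧸ K)]

/-- Instance of `curvatureEndo_of_killing_family` for the action fields in the chart at the base
point. -/
theorem curvatureEndo_projDeriv
    (hπ : IsSubmersion 𝓘(ℝ, E) 𝓘(ℝ, F) ∞ (fun a : G ↦ (a : G ⧸ K)))
    (g : SmoothMetric F (G ⧸ K))
    (hg : ∀ (a : G) (x : G ⧸ K) (u v : TangentSpace 𝓘(ℝ, F) x),
      g.inner (a • x) (mfderiv 𝓘(ℝ, F) 𝓘(ℝ, F) (fun y : G ⧸ K ↦ a • y) x u)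
        (mfderiv 𝓘(ℝ, F) 𝓘(ℝ, F) (fun y : G ⧸ K ↦ a • y) x v) = g.inner x u v)
    (p : Set (GroupLieAlgebra 𝓘(ℝ, E) G))
    (h0 : ∀ X ∈ p, ∀ Y ∈ p, projDeriv E F K ⁅X, Y⁆ = 0)
    (hsurj : ∀ v, ∃ X ∈ p, projDeriv E F K X = v)
    {X Y W : GroupLieAlgebra 𝓘(ℝ, E) G} (hX : X ∈ p) (hY : Y ∈ p) :
    curvatureEndo (g.inChart ((1 : G) : G ⧸ K))
      (extChartAt 𝓘(ℝ, F) ((1 : G) : G ⧸ K) ((1 : G) : G ⧸ K)) (projDeriv E F K X)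
        (projDeriv E F K Y) (projDeriv E F K W) = projDeriv E F K ⁅W, ⁅X, Y⁆⁆ := by
  set o : G ⧸ K := ((1 : G) : G ⧸ K) with ho
  have hs := contMDiff_quotient_smul hπ
  have hΦ := contDiffAt_chartSmul hs o
  have ho' := mem_extChartAt_target (I := 𝓘(ℝ, F)) o
  have hb := contDiffAt_inChart g ho'
  have hS : ∀ X : E, actionField (chartSmul E F G o) (extChartAt 𝓘(ℝ, E) (1 : G) 1) X
      (extChartAt 𝓘(ℝ, F) o o) = projDeriv E F K X := actionField_chartSmul hπ
  have h1 := eventually_chartSmul_one (E := E) (F := F) (G := G) o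
  have hbr : ∀ X Y : GroupLieAlgebra 𝓘(ℝ, E) G, ∀ᶠ z in 𝓝 (extChartAt 𝓘(ℝ, F) o o),
      fderiv ℝ (actionField (E := E) (chartSmul E F G o) (extChartAt 𝓘(ℝ, E) (1 : G) 1) Y) z
        (actionField (E := E) (chartSmul E F G o) (extChartAt 𝓘(ℝ, E) (1 : G) 1) X z) -
      fderiv ℝ (actionField (E := E) (chartSmul E F G o) (extChartAt 𝓘(ℝ, E) (1 : G) 1) X) z
        (actionField (E := E) (chartSmul E F G o) (extChartAt 𝓘(ℝ, E) (1 : G) 1) Y z) =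
      -actionField (E := E) (chartSmul E F G o) (extChartAt 𝓘(ℝ, E) (1 : G) 1)
        (⁅X, Y⁆ : GroupLieAlgebra 𝓘(ℝ, E) G) z := by
    intro X Y
    rw [groupLieAlgebra_bracket_eq]
    exact actionField_bracket hΦ contDiffAt_chartMul h1 (eventually_chartSmul_one (1 : G))
      eventually_chartSmul_self_one (eventually_chartSmul_assoc hs o) X Y
  have hS' : ∀ X : E, ContDiffAt ℝ ∞ (actionField (chartSmul E F G o)
      (extChartAt 𝓘(ℝ, E) (1 : G) 1) X) (extChartAt 𝓘(ℝ, F) o o) := contDiffAt_actionField hΦ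
  have hK : ∀ X : E, IsKillingFieldAt (g.inChart o) (actionField (chartSmul E F G o)
      (extChartAt 𝓘(ℝ, E) (1 : G) 1) X) (extChartAt 𝓘(ℝ, F) o o) :=
    isKillingFieldAt_actionField hb hΦ h1 (eventually_inChart_chartSmul hs o g hg)
  have hi : ∀ᶠ z in 𝓝 (extChartAt 𝓘(ℝ, F) o o), (g.inChart o z).IsInvertible :=
    Filter.mem_of_superset (extChartAt_target_mem_nhds o) fun z hz ↦ isInvertible_inChart g hz
  obtain ⟨S, hSdef⟩ : ∃ S : GroupLieAlgebra 𝓘(ℝ, E) G → F → F, S = fun X ↦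
    actionField (E := E) (chartSmul E F G o) (extChartAt 𝓘(ℝ, E) (1 : G) 1) X := ⟨_, rfl⟩
  have hS0 : ∀ X, S X (extChartAt 𝓘(ℝ, F) o o) = projDeriv E F K X := fun X ↦
    (congrArg (fun S : GroupLieAlgebra 𝓘(ℝ, E) G → F → F ↦ S X _) hSdef).trans (hS X)
  have key := curvatureEndo_of_killing_family hb
    (Filter.Eventually.of_forall (inChart_symm g o)) hi S (hSdef ▸ hS') (hSdef ▸ hK)
    (hSdef ▸ hbr) p (fun X hX Y hY ↦ (hS0 _).trans (h0 X hX Y hY))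
    (fun v ↦ (hsurj v).imp fun X hX ↦ ⟨hX.1, (hS0 X).trans hX.2⟩) (W := W) hX hY
  have hcongr : ∀ x x' y y' w w' : F, x = x' → y = y' → w = w' →
      curvatureEndo (g.inChart o) (extChartAt 𝓘(ℝ, F) o o) x y w =
        curvatureEndo (g.inChart o) (extChartAt 𝓘(ℝ, F) o o) x' y' w' := by
    rintro _ _ _ _ _ _ rfl rfl rfl
    rfl
  exact (hcongr _ _ _ _ _ _ (hS0 X) (hS0 Y) (hS0 W)).symm.trans (key.trans (hS0 _))

end SymmetricSpace

section SymmetricSpaceOfInvolution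

variable {E F : Type*} [NormedAddCommGroup E] [NormedSpace ℝ E] [CompleteSpace E]
  [NormedAddCommGroup F] [NormedSpace ℝ F] [FiniteDimensional ℝ F] [CompleteSpace F]
  {G : Type*} [TopologicalSpace G] [ChartedSpace E G] [Group G] [LieGroup 𝓘(ℝ, E) ∞ G]
  {K : Subgroup G} [ChartedSpace F (G ⧸ K)] [IsManifold 𝓘(ℝ, F) ∞ (G ⧸ K)]
  {θ : GroupLieAlgebra 𝓘(ℝ, E) G ≃ₗ⁅ℝ⁆ GroupLieAlgebra 𝓘(ℝ, E) G}
  {s : TangentSpace 𝓘(ℝ, F) ((1 : G) : G ⧸ K) →ₗ[ℝ] GroupLieAlgebra 𝓘(ℝ, E) G}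

/-- g(R(X, Y)W, Z) = -B([W, [X, Y]], Z), and invariance of B moves W to the other side. -/
theorem riemann_eq_neg_killingForm
    (hπ : IsSubmersion 𝓘(ℝ, E) 𝓘(ℝ, F) ∞ (fun a : G ↦ (a : G ⧸ K)))
    (g : SmoothMetric F (G ⧸ K)) (hg : IsInducedByKilling E K g)
    [LieAlgebra.IsKilling ℝ (GroupLieAlgebra 𝓘(ℝ, E) G)]
    (h : IsSymmetricPair θ (subgroupLieAlgebra (E := E) K))
    (H : IsTangentModel θ (g.form ((1 : G) : G ⧸ K)) (projDeriv E F K).toLinearMap s)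
    (X Y Z W : TangentSpace 𝓘(ℝ, F) ((1 : G) : G ⧸ K)) :
    g.riemann ((1 : G) : G ⧸ K) X Y Z W =
      -killingForm ℝ (GroupLieAlgebra 𝓘(ℝ, E) G) ⁅s X, s Y⁆ ⁅s Z, s W⁆ := by
  have hmem : ∀ v, s v ∈ killingComplement (subgroupLieAlgebra (E := E) K) := fun v ↦
    (h.mem_killingComplement_iff _).mpr (H.map_incl v)
  have hbr := h.lie_neg_of_mem (h.lie_mem (H.map_incl X) (H.map_incl Y)) (H.map_incl W)
  have hbr' : θ ⁅s W, ⁅s X, s Y⁆⁆ = -⁅s W, ⁅s X, s Y⁆⁆ := by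
    rw [← lie_skew, map_neg, hbr]
  have hp : ∀ v, projDeriv E F K (s v) = v := H.proj_incl
  have h1 := curvatureEndo_projDeriv hπ g hg.invariant
    {X | θ X = -X} (fun X hX Y hY ↦ H.proj_of_mem h (h.lie_mem hX hY))
    (fun v ↦ ⟨s v, H.map_incl v, hp v⟩) (W := s W) (H.map_incl X) (H.map_incl Y)
  have h2 := hg.at_base _ ((h.mem_killingComplement_iff _).mpr hbr') _ (hmem Z)
  have hcongr : ∀ x x' y y' w w' z z' : F, x = x' → y = y' → w = w' → z = z' →
      g.form ((1 : G) : G ⧸ K) (curvatureEndo (E := F) (g.inChart ((1 : G) : G ⧸ K))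
        (extChartAt 𝓘(ℝ, F) ((1 : G) : G ⧸ K) ((1 : G) : G ⧸ K)) x y w) z =
      g.form ((1 : G) : G ⧸ K) (curvatureEndo (E := F) (g.inChart ((1 : G) : G ⧸ K))
        (extChartAt 𝓘(ℝ, F) ((1 : G) : G ⧸ K) ((1 : G) : G ⧸ K)) x' y' w') z' := by
    rintro _ _ _ _ _ _ _ _ rfl rfl rfl rfl
    rfl
  have h3 := congrArg (fun u : F ↦ g.form ((1 : G) : G ⧸ K) u (projDeriv E F K (s Z))) h1
  refine (riemann_apply g _ X Y Z W).trans ((hcongr _ _ _ _ _ _ _ _ (hp X) (hp Y) (hp W)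
    (hp Z)).symm.trans (h3.trans (h2.trans ?_)))
  rw [← lie_skew (s W), ← lie_skew (s Z) (s W), map_neg, map_neg, LinearMap.neg_apply,
    LieModule.traceForm_apply_lie_apply]

end SymmetricSpaceOfInvolution

end

theorem mainTheorem3 {n m : ℕ} {G : Type*} [TopologicalSpace G]
    [ChartedSpace (EuclideanSpace ℝ (Fin n)) G] [Group G] [LieGroup (𝓡 n) ∞ G]
    [IsTopologicalGroup G] [T2Space G] [CompactSpace G]
    [LieAlgebra.HasTrivialRadical ℝ (GroupLieAlgebra (𝓡 n) G)]
    (σ : G ≃* G) (hσ : ContMDiff (𝓡 n) (𝓡 n) ∞ σ) (hinv : ∀ a, σ (σ a) = a)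
    [ChartedSpace (EuclideanSpace ℝ (Fin m)) (G ⧸ fixedIdentityComponent σ)]
    [IsManifold (𝓡 m) ∞ (G ⧸ fixedIdentityComponent σ)]
    (hπ : IsSubmersion (𝓡 n) (𝓡 m) ∞ (fun a : G ↦ (a : G ⧸ fixedIdentityComponent σ)))
    (g : SmoothMetric (EuclideanSpace ℝ (Fin m)) (G ⧸ fixedIdentityComponent σ))
    (hg : IsInducedByKilling (EuclideanSpace ℝ (Fin n)) (fixedIdentityComponent σ) g) :
    let o : G ⧸ fixedIdentityComponent σ := ((1 : G) : G ⧸ fixedIdentityComponent σ)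
    let 𝔤 := GroupLieAlgebra (𝓡 n) G
    let 𝔥 : LieSubalgebra ℝ 𝔤 := subgroupLieAlgebra (fixedIdentityComponent σ)
    ∃ (ι : 𝔥 →ₗ[ℝ] ⋀[ℝ]^2 (TangentSpace (𝓡 m) o)) (P : 𝔥 →ₗ[ℝ] 𝔥)
      (T : ⋀[ℝ]^2 (TangentSpace (𝓡 m) o) →ₗ[ℝ] ⋀[ℝ]^2 (TangentSpace (𝓡 m) o)),
      (IsIsotropyEmbedding g ι ∧ ∀ ι', IsIsotropyEmbedding g ι' → ι' = ι) ∧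
      (IsKillingRatio 𝔥 P ∧ ∀ P', IsKillingRatio 𝔥 P' → P' = P) ∧
      (g.IsCurvatureOperator o T ∧ ∀ T', g.IsCurvatureOperator o T' → T' = T) ∧
      ((∀ J : LieIdeal ℝ 𝔤, (∀ X ∈ J, X ∈ 𝔥) → J = ⊥) → Function.Injective ι) ∧
      T ∘ₗ ι = ι ∘ₗ ((1 / 2 : ℝ) • (LinearMap.id - P)) ∧
      (∀ β, (∀ Z, bivectorForm (g.form o) (ι Z) β = 0) → T β = 0) := by
  intro o 𝔤 𝔥
  have hfin : FiniteDimensional ℝ 𝔤 :=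
    inferInstanceAs (FiniteDimensional ℝ (EuclideanSpace ℝ (Fin n)))
  have hfin' : FiniteDimensional ℝ (TangentSpace (𝓡 m) o) :=
    inferInstanceAs (FiniteDimensional ℝ (EuclideanSpace ℝ (Fin m)))
  have hsym : IsSymmetricPair (involutionDifferential σ hσ hinv) 𝔥 :=
    ⟨fderiv_chartMap_fderiv_chartMap (E := EuclideanSpace ℝ (Fin n)) σ hσ hinv,
      mem_subgroupLieAlgebra_fixedIdentityComponent_iff σ hσ hinv⟩
  -- Semisimplicity enters here as nondegeneracy of the Killing form. The projection kills the fixed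
  -- vectors of θ because they are velocities of curves in the subgroup.
  obtain ⟨s, H⟩ := hsym.exists_isTangentModel (b := g.form o)
    (pr := (projDeriv (EuclideanSpace ℝ (Fin n)) (EuclideanSpace ℝ (Fin m))
      (fixedIdentityComponent σ)).toLinearMap) (projDeriv_surjective hπ)
    (fun X hX ↦ by
      obtain ⟨γ, h1, h2, h3, h4⟩ :=
        exists_curve_fixedIdentityComponent (E := EuclideanSpace ℝ (Fin n)) σ hσ hinv hX
      exact projDeriv_eq_zero_of_curve hπ h1 h2 h3 h4)
    (fun X Y hX hY ↦ hg.at_base X ((hsym.mem_killingComplement_iff X).mpr hX) Y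
      ((hsym.mem_killingComplement_iff Y).mpr hY))
  exact H.exists_curvatureOperator hsym (g.riemann o) (riemann_eq_neg_killingForm hπ g hg hsym H)
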